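/- Let $n\ge 1$, $p>1$, $0<\beta<2$, and let $f:\mathbb R\to\mathbb R$ satisfy $f(0)=0$ and $$|f(a)-f(b)|\le C|a-b|\left(e^{\lambda|a|^p}+e^{\lambda|b|^p}\right)\qquad\text{for all }a,b\in\mathbb R,$$ for some constants $C>0$, $\lambda>0$. Let $\exp L^p(\mathbb R^n)$ be the space of all $u\in L^1_{loc}(\mathbb R^n)$ (functions being identified when equal almost everywhere) such that $\int_{\mathbb R^n}\left(e^{|u(x)|^p/l^p}-1\right)dx<\infty$ for some $l>0$, with the Luxemburg norm $$\|u\|_{\exp L^p}=\inf\Big\{l>0:\ \int_{\mathbb R^n}\left(e^{|u(x)|^p/l^p}-1\right)dx\le 1\Big\},$$ and let $\exp L^p_0(\mathbb R^n)$ be the closure of $C_0^\infty(\mathbb R^n)$ in it. For $t>0$ put $$S_\beta(x,t)=\frac1{(2\pi)^n}\int_{\mathbb R^n}e^{ix\cdot\xi-t|\xi|^\beta}\,d\xi,\qquad e^{-t(-\Delta)^{\beta/2}}g=S_\beta(\cdot,t)*g,$$ and let $e^{-t(-\Delta)^{\beta/2}}$ be the identity for $t=0$. Given $u_0\in\exp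 L^p_0(\mathbb R^n)$ and $T>0$, a mild solution on $[0,T]$ of $$u_t+(-\Delta)^{\beta/2}u=f(u),\qquad u(0)=u_0,$$ is a function $u\in C([0,T];\exp L^p_0(\mathbb R^n))$ such that for every $t\in[0,T]$, almost everywhere in $\mathbb R^n$ and with absolutely convergent time integral, $$u(t)=e^{-t(-\Delta)^{\beta/2}}u_0+\int_0^t e^{-(t-s)(-\Delta)^{\beta/2}}f(u(s))\,ds .$$ Then for every $u_0\in\exp L^p_0(\mathbb R^n)$ there exists $T=T(u_0)>0$ such that this problem has exactly one mild solution $u\in C([0,T];\exp L^p_0(\mathbb R^n))$ on $[0,T]$. -/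

import Mathlib

noncomputable section

namespace FracHeat

open MeasureTheory Filter Topology Set
open scoped ENNReal

/-- `ℝⁿ` with its Euclidean norm. -/
abbrev E (n : ℕ) : Type := EuclideanSpace ℝ (Fin n)

/-- Real measurable functions on `ℝⁿ` up to Lebesgue-a.e. equality. -/
abbrev Fn (n : ℕ) : Type := E n →ₘ[(volume : Measure (E n))] ℝ

/-- The modular `∫ (exp (|u|^p / l^p) - 1) dx`, as a number in `[0, ∞]`. -/
def modular {n : ℕ} (p : ℝ) (u : E n → ℝ) (l : ℝ) : ℝ≥0∞ :=
  ∫⁻ x, ENNReal.ofReal (Real.exp (|u x| ^ p / l ^ p) - 1)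

/-- The Luxemburg norm of `exp L^p`; it is `∞` when no admissible `l` exists. -/
def luxNorm {n : ℕ} (p : ℝ) (u : E n → ℝ) : ℝ≥0∞ :=
  ⨅ (l : ℝ) (_ : 0 < l) (_ : modular p u l ≤ 1), ENNReal.ofReal l

/-- The Orlicz space `exp L^p(ℝⁿ)`. -/
def expL (n : ℕ) (p : ℝ) : Set (Fn n) :=
  {u | LocallyIntegrable u ∧ ∃ l : ℝ, 0 < l ∧ modular p u l < ⊤}

/-- The closure `exp L^p_0(ℝⁿ)` of the smooth compactly supported functions in `exp L^p(ℝⁿ)`. -/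
def expLZero (n : ℕ) (p : ℝ) : Set (Fn n) :=
  {u | u ∈ expL n p ∧ ∃ φ : ℕ → E n → ℝ,
    (∀ k, ContDiff ℝ ((⊤ : ℕ∞) : WithTop ℕ∞) (φ k) ∧ HasCompactSupport (φ k)) ∧
    Tendsto (fun k => luxNorm p (fun x => φ k x - u x)) atTop (𝓝 0)}

/-- The fundamental solution
`S_β(x,t) = (2π)^{-n} ∫ exp (i x·ξ - t |ξ|^β) dξ`, for `t > 0`. The integral is a real number
(the integrand at `-ξ` is the conjugate of the integrand at `ξ`), so taking the real part only
changes its type. -/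
def kernel {n : ℕ} (β t : ℝ) (x : E n) : ℝ :=
  ((2 * Real.pi) ^ n)⁻¹ *
    (∫ ξ : E n, Complex.exp (Complex.I * ((inner ℝ x ξ : ℝ) : ℂ) -
      ((t * ‖ξ‖ ^ β : ℝ) : ℂ))).re

/-- The semigroup `e^{-t(-Δ)^{β/2}} g`, evaluated at `x`: convolution with the fundamental
solution for `t > 0`, the identity at `t = 0`. -/
def semigroup {n : ℕ} (β t : ℝ) (g : E n → ℝ) (x : E n) : ℝ :=
  if t = 0 then g x else ∫ y : E n, kernel β t (x - y) * g y

/-- `u ∈ C([0,T]; exp L^p_0(ℝⁿ))` (only the values `u t` for `t ∈ [0,T]` matter). -/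
structure IsContinuousCurve {n : ℕ} (p T : ℝ) (u : ℝ → Fn n) : Prop where
  mem : ∀ t ∈ Icc 0 T, u t ∈ expLZero n p
  cont : ∀ t₀ ∈ Icc 0 T,
    Tendsto (fun t => luxNorm p (fun x => u t x - u t₀ x)) (𝓝[Icc 0 T] t₀) (𝓝 0)

/-- `u` is a mild solution on `[0,T]` of `u_t + (-Δ)^{β/2} u = f(u)`, `u(0) = u₀`: it is a
continuous curve in `exp L^p_0(ℝⁿ)`, and for every `t ∈ [0,T]` the Duhamel formula holds a.e. in
`ℝⁿ`, the time integral being absolutely convergent. -/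
structure IsMildSolution {n : ℕ} (p β : ℝ) (f : ℝ → ℝ) (u₀ : Fn n) (T : ℝ)
    (u : ℝ → Fn n) : Prop where
  curve : IsContinuousCurve p T u
  duhamel : ∀ t ∈ Icc 0 T, ∀ᵐ x : E n,
    IntervalIntegrable (fun s => semigroup β (t - s) (fun y => f (u s y)) x) volume 0 t ∧
    u t x = semigroup β t u₀ x + ∫ s in (0 : ℝ)..t, semigroup β (t - s) (fun y => f (u s y)) x

end FracHeat

end

noncomputable section

namespace FracHeat

open MeasureTheory Filter Topology Set
open scoped ENNReal

/-! ### Positivity and mass of the fundamental solution -/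

/-! The density `S_β(·,1)` is nonnegative, bounded and of mass one. Positivity is Bochner
subordination: `|ξ|^β` is a positive multiple of `∫ (1 - e^{-s|ξ|²}) s^{-1-β/2} ds`, so `e^{-|ξ|^β}`
is a limit of positive mixtures of Gaussians, whose Fourier transforms are positive. By scaling, the
semigroup at time `t` averages a function over the translates `x - t^{1/β} z` under a fixed law `P`
(`semigroup_eq_avg`), and afterwards only two facts about `P` are used: it is a probability measure,
and it is at most a constant times Lebesgue measure.

The space `exp L^p_0` is the Orlicz heart, where `∫ (e^{μ|u|^p} - 1)` is finite for every `μ`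
(`isHeart_of_mem_expLZero`, `mem_expLZero_of_isHeart`). Hence the losses in the rate `μ` caused by
splitting sums are harmless. By Jensen, averaging does not increase these integrals
(`expInt_avg_le`). The bounded density gives smoothing: averages of `f(u)` at time `τ` are bounded
by a multiple of `τ^{-n/(βq)}` once the integral at rate `2λq` is finite, and `q` can be taken so
large that this singularity is integrable in time (`lintegral_exp_sub_smul_le`,
`ExpGrowth.abs_avg_comp_le`).

For existence write `u = a + w` with `a` the free evolution of `u₀` and `w` the Duhamel term. Among
`w` with `|w| ≤ 1` and `∫ |w|^p ≤ 1` the exponential integrals of `a + w` are uniformly bounded, so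
for small `T` the Duhamel map preserves this class and halves uniform distances
(`PicardData.exists_fixed_point`). A bounded function is small in the space as soon as it is small
in `L^p`. Thus norm continuity reduces to continuity of translations in `L^p`, in space for `a`
(after truncating `u₀`) and in space-time for `w`.

For uniqueness, compactness of `[0,T]` bounds the exponential integrals of two arbitrary solutions.
Smoothing makes their difference bounded, and a singular Grönwall argument with weight `e^{γt}`
makes it zero (`IsMildSolution.unique`). -/

lemma integrable_gaussian {n : ℕ} {δ : ℝ} (hδ : 0 < δ) :
    Integrable (fun ξ : E n => Real.exp (-δ * ‖ξ‖ ^ 2)) := by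
  have h := (GaussianFourier.integrable_cexp_neg_mul_sq_norm_add (V := E n) (b := (δ : ℂ))
    (by simpa using hδ) 0 0).norm
  refine h.congr (Eventually.of_forall fun ξ => ?_)
  simp only [Complex.norm_exp]
  congr 1
  norm_cast
  simp

lemma integral_cos_mul_gaussian {n : ℕ} {δ : ℝ} (hδ : 0 < δ) (x : E n) :
    ∫ ξ : E n, Real.cos (inner ℝ x ξ) * Real.exp (-δ * ‖ξ‖ ^ 2) =
      (Real.pi / δ) ^ (n / 2 : ℝ) * Real.exp (-‖x‖ ^ 2 / (4 * δ)) := by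
  have hb : 0 < ((δ : ℂ)).re := by simpa using hδ
  have h := GaussianFourier.integral_cexp_neg_mul_sq_norm_add (V := E n) hb Complex.I x
  have hi := GaussianFourier.integrable_cexp_neg_mul_sq_norm_add (V := E n) hb Complex.I x
  have h2 := congrArg Complex.re h
  have h3 := Complex.reCLM.integral_comp_comm hi
  simp only [Complex.reCLM_apply] at h3
  rw [← h3] at h2
  convert h2 using 1
  · refine integral_congr_ae (Eventually.of_forall fun ξ => ?_)
    simp only [Complex.exp_re]
    have e1 : (-(δ : ℂ) * (‖ξ‖ : ℂ) ^ 2 + Complex.I * ((inner ℝ x ξ : ℝ) : ℂ)).re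
        = -δ * ‖ξ‖ ^ 2 := by
      simp [← Complex.ofReal_pow]
    have e2 : (-(δ : ℂ) * (‖ξ‖ : ℂ) ^ 2 + Complex.I * ((inner ℝ x ξ : ℝ) : ℂ)).im
        = inner ℝ x ξ := by
      simp [← Complex.ofReal_pow]
    rw [e1, e2, mul_comm]
  · rw [finrank_euclideanSpace_fin, Complex.I_sq]
    have : ((Real.pi : ℂ) / δ) ^ ((n : ℂ) / 2) * Complex.exp (-1 * (‖x‖ : ℂ) ^ 2 / (4 * δ)) =
        (((Real.pi / δ) ^ (n / 2 : ℝ) * Real.exp (-‖x‖ ^ 2 / (4 * δ)) : ℝ) : ℂ) := by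
      rw [Complex.ofReal_mul, Complex.ofReal_cpow (by positivity)]
      push_cast
      simp
    rw [this, Complex.ofReal_re]

/-- Functions whose product with every centred Gaussian has a nonnegative cosine transform. -/
def CosPositive {n : ℕ} (h : E n → ℝ) : Prop :=
  ∀ δ : ℝ, 0 < δ → ∀ x : E n,
    0 ≤ ∫ ξ : E n, Real.cos (inner ℝ x ξ) * (h ξ * Real.exp (-δ * ‖ξ‖ ^ 2))

lemma continuous_cos_inner {n : ℕ} (x : E n) :
    Continuous fun ξ : E n => Real.cos (inner ℝ x ξ) := by fun_prop

lemma integrable_cos_mul {n : ℕ} (x : E n) {g : E n → ℝ} (hg : Integrable g) :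
    Integrable (fun ξ : E n => Real.cos (inner ℝ x ξ) * g ξ) :=
  hg.bdd_mul (c := 1) (continuous_cos_inner x).aestronglyMeasurable
    (Eventually.of_forall fun ξ => by simpa using Real.abs_cos_le_one _)

lemma integrable_bdd_mul_gaussian {n : ℕ} {h : E n → ℝ} {B δ : ℝ} (hm : Measurable h)
    (hB : ∀ ξ, |h ξ| ≤ B) (hδ : 0 < δ) :
    Integrable (fun ξ : E n => h ξ * Real.exp (-δ * ‖ξ‖ ^ 2)) :=
  (integrable_gaussian hδ).bdd_mul hm.aestronglyMeasurable (Eventually.of_forall hB)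

lemma CosPositive.one {n : ℕ} : CosPositive (fun _ : E n => 1) := by
  intro δ hδ x
  simp only [one_mul]
  rw [integral_cos_mul_gaussian hδ]
  positivity

lemma CosPositive.const_mul {n : ℕ} {h : E n → ℝ} (hh : CosPositive h) {c : ℝ} (hc : 0 ≤ c) :
    CosPositive (fun ξ => c * h ξ) := by
  intro δ hδ x
  have : ∀ ξ : E n, Real.cos (inner ℝ x ξ) * (c * h ξ * Real.exp (-δ * ‖ξ‖ ^ 2)) =
      c * (Real.cos (inner ℝ x ξ) * (h ξ * Real.exp (-δ * ‖ξ‖ ^ 2))) := fun ξ => by ring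
  simp only [this, integral_const_mul]
  exact mul_nonneg hc (hh δ hδ x)

lemma CosPositive.sum {n : ℕ} {h : ℕ → E n → ℝ} {B : ℕ → ℝ} (N : ℕ)
    (hh : ∀ k, CosPositive (h k)) (hm : ∀ k, Measurable (h k)) (hB : ∀ k ξ, |h k ξ| ≤ B k) :
    CosPositive (fun ξ => ∑ k ∈ Finset.range N, h k ξ) := by
  intro δ hδ x
  simp only [Finset.sum_mul, Finset.mul_sum]
  rw [integral_finsetSum _ fun k _ =>
    integrable_cos_mul x (integrable_bdd_mul_gaussian (hm k) (hB k) hδ)]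
  exact Finset.sum_nonneg fun k _ => hh k δ hδ x

/-- The Gaussian factor is the dominating function, so uniformly bounded pointwise convergence
suffices and the limit need not be integrable. -/
lemma CosPositive.of_tendsto {n : ℕ} {h : ℕ → E n → ℝ} {g : E n → ℝ} {B : ℝ}
    (hh : ∀ k, CosPositive (h k)) (hm : ∀ k, Measurable (h k)) (hB : ∀ k ξ, |h k ξ| ≤ B)
    (hlim : ∀ ξ, Tendsto (fun k => h k ξ) atTop (𝓝 (g ξ))) : CosPositive g := by
  intro δ hδ x
  refine ge_of_tendsto' (f := fun k => ∫ ξ : E n, Real.cos (inner ℝ x ξ) *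
    (h k ξ * Real.exp (-δ * ‖ξ‖ ^ 2))) (x := atTop) ?_ fun k => hh k δ hδ x
  refine tendsto_integral_of_dominated_convergence (fun ξ => B * Real.exp (-δ * ‖ξ‖ ^ 2))
    (fun k => (integrable_cos_mul x
      (integrable_bdd_mul_gaussian (hm k) (hB k) hδ)).aestronglyMeasurable)
    ((integrable_gaussian hδ).const_mul B) (fun k => Eventually.of_forall fun ξ => ?_)
    (Eventually.of_forall fun ξ => ((hlim ξ).mul_const _).const_mul _)
  rw [norm_mul, norm_mul, Real.norm_eq_abs, Real.norm_eq_abs, Real.norm_eq_abs, Real.abs_exp]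
  calc _ ≤ 1 * (B * Real.exp (-δ * ‖ξ‖ ^ 2)) := by
        gcongr
        · exact Real.abs_cos_le_one _
        · exact hB k ξ
    _ = _ := one_mul _

/-- The Laplace transform of the truncated stable Lévy measure `s^{-1-α} ds` on `(ε, ∞)`. -/
def truncLevy (α ε r : ℝ) : ℝ := ∫ s in Ioi ε, Real.exp (-s * r) * s ^ (-1 - α)

lemma integrableOn_levy {α ε : ℝ} (hα : 0 < α) (hε : 0 < ε) :
    IntegrableOn (fun s : ℝ => s ^ (-1 - α)) (Ioi ε) :=
  integrableOn_Ioi_rpow_of_lt (by linarith) hε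

lemma integrableOn_exp_mul_levy {α ε r : ℝ} (hα : 0 < α) (hε : 0 < ε) (hr : 0 ≤ r) :
    IntegrableOn (fun s : ℝ => Real.exp (-s * r) * s ^ (-1 - α)) (Ioi ε) := by
  refine (integrableOn_levy hα hε).bdd_mul (c := 1) (by fun_prop)
    ((ae_restrict_iff' measurableSet_Ioi).2 (Eventually.of_forall fun s hs => ?_))
  rw [Real.norm_eq_abs, Real.abs_exp, Real.exp_le_one_iff]
  have : 0 < s := hε.trans hs
  nlinarith [mul_nonneg this.le hr]

lemma truncLevy_nonneg {α ε r : ℝ} (hε : 0 < ε) : 0 ≤ truncLevy α ε r :=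
  setIntegral_nonneg measurableSet_Ioi fun s hs => by
    have : 0 < s := hε.trans hs
    positivity

lemma truncLevy_le {α ε r : ℝ} (hα : 0 < α) (hε : 0 < ε) (hr : 0 ≤ r) :
    truncLevy α ε r ≤ truncLevy α ε 0 := by
  refine setIntegral_mono_on (integrableOn_exp_mul_levy hα hε hr)
    (integrableOn_exp_mul_levy hα hε le_rfl) measurableSet_Ioi fun s hs => ?_
  have h0 : 0 < s := hε.trans hs
  have := mul_nonneg h0.le hr
  gcongr ?_ * _
  simpa using this

lemma measurable_truncLevy (α ε : ℝ) : Measurable (truncLevy α ε) := by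
  have : StronglyMeasurable fun q : ℝ × ℝ => Real.exp (-q.2 * q.1) * q.2 ^ (-1 - α) :=
    Measurable.stronglyMeasurable (by fun_prop)
  exact (this.integral_prod_right (ν := volume.restrict (Ioi ε))).measurable

/-- By Fubini the transform is a positive superposition over `s` of transforms of `h` against
Gaussians of parameter `δ + s`. This is why `CosPositive` ranges over all Gaussian parameters. -/
lemma CosPositive.mul_truncLevy {n : ℕ} {h : E n → ℝ} {B α ε : ℝ} (hα : 0 < α) (hε : 0 < ε)
    (hh : CosPositive h) (hm : Measurable h) (hB : ∀ ξ, |h ξ| ≤ B) :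
    CosPositive (fun ξ => h ξ * truncLevy α ε (‖ξ‖ ^ 2)) := by
  intro δ hδ x
  have e1 : ∀ ξ : E n, Real.cos (inner ℝ x ξ) *
      (h ξ * truncLevy α ε (‖ξ‖ ^ 2) * Real.exp (-δ * ‖ξ‖ ^ 2)) =
      ∫ s in Ioi ε, Real.cos (inner ℝ x ξ) * (h ξ * Real.exp (-δ * ‖ξ‖ ^ 2)) *
        (Real.exp (-s * ‖ξ‖ ^ 2) * s ^ (-1 - α)) := by
    intro ξ
    rw [integral_const_mul, truncLevy]
    ring
  simp only [e1]
  rw [integral_integral_swap]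
  · refine setIntegral_nonneg measurableSet_Ioi fun s hs => ?_
    have hs0 : 0 < s := hε.trans hs
    have e2 : ∀ ξ : E n, Real.cos (inner ℝ x ξ) * (h ξ * Real.exp (-δ * ‖ξ‖ ^ 2)) *
        (Real.exp (-s * ‖ξ‖ ^ 2) * s ^ (-1 - α)) =
        s ^ (-1 - α) * (Real.cos (inner ℝ x ξ) * (h ξ * Real.exp (-(δ + s) * ‖ξ‖ ^ 2))) := by
      intro ξ
      have : Real.exp (-(δ + s) * ‖ξ‖ ^ 2) =
          Real.exp (-δ * ‖ξ‖ ^ 2) * Real.exp (-s * ‖ξ‖ ^ 2) := by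
        rw [← Real.exp_add]; ring_nf
      rw [this]; ring
    simp only [e2, integral_const_mul]
    exact mul_nonneg (by positivity) (hh _ (by positivity) x)
  · have i1 := (integrable_cos_mul x (integrable_bdd_mul_gaussian hm hB hδ)).mul_prod
      (ν := volume.restrict (Ioi ε)) (integrableOn_levy hα hε)
    refine i1.mono (Measurable.aestronglyMeasurable (by fun_prop)) ?_
    have hae : ∀ᵐ q : E n × ℝ ∂(volume.prod (volume.restrict (Ioi ε))), q.2 ∈ Ioi ε :=
      Measure.quasiMeasurePreserving_snd.ae (ae_restrict_mem measurableSet_Ioi)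
    filter_upwards [hae] with q hq
    have hq0 : 0 < q.2 := hε.trans hq
    have hle : ‖Real.exp (-q.2 * ‖q.1‖ ^ 2)‖ ≤ 1 := by
      rw [Real.norm_eq_abs, Real.abs_exp, Real.exp_le_one_iff]
      nlinarith [mul_nonneg hq0.le (sq_nonneg ‖q.1‖)]
    simp only [Function.uncurry, norm_mul]
    exact mul_le_mul_of_nonneg_left (mul_le_of_le_one_left (norm_nonneg _) hle) (by positivity)

lemma CosPositive.truncLevy_pow {n : ℕ} {α ε : ℝ} (hα : 0 < α) (hε : 0 < ε) (k : ℕ) :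
    CosPositive (fun ξ : E n => truncLevy α ε (‖ξ‖ ^ 2) ^ k) := by
  induction k with
  | zero => simpa using CosPositive.one
  | succ k ih =>
    simp only [pow_succ]
    refine ih.mul_truncLevy (B := truncLevy α ε 0 ^ k) hα hε
      (((measurable_truncLevy α ε).comp (by fun_prop)).pow_const k) fun ξ => ?_
    rw [abs_of_nonneg (pow_nonneg (truncLevy_nonneg hε) k)]
    exact pow_le_pow_left₀ (truncLevy_nonneg hε) (truncLevy_le hα hε (by positivity)) k

/-- The exponential series has nonnegative coefficients, each power is covered by
`CosPositive.truncLevy_pow`, and the partial sums are bounded by the exponential at frequency zero.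
-/
lemma CosPositive.exp_truncLevy {n : ℕ} {α ε c : ℝ} (hα : 0 < α) (hε : 0 < ε) (hc : 0 ≤ c) :
    CosPositive (fun ξ : E n => Real.exp (c * truncLevy α ε (‖ξ‖ ^ 2))) := by
  have hm : Measurable fun ξ : E n => truncLevy α ε (‖ξ‖ ^ 2) :=
    (measurable_truncLevy α ε).comp (by fun_prop)
  have hle : ∀ ξ : E n, truncLevy α ε (‖ξ‖ ^ 2) ≤ truncLevy α ε 0 := fun ξ =>
    truncLevy_le hα hε (by positivity)
  have h0 : ∀ ξ : E n, 0 ≤ truncLevy α ε (‖ξ‖ ^ 2) := fun ξ => truncLevy_nonneg hε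
  have key : ∀ N, CosPositive fun ξ : E n =>
      ∑ k ∈ Finset.range N, (c * truncLevy α ε (‖ξ‖ ^ 2)) ^ k / (k.factorial : ℝ) := by
    intro N
    refine CosPositive.sum (B := fun k => (c * truncLevy α ε 0) ^ k / (k.factorial : ℝ)) N
      (fun k => ?_) (fun k => ((hm.const_mul c).pow_const k).div_const _) fun k ξ => ?_
    · have := (CosPositive.truncLevy_pow (n := n) hα hε k).const_mul
        (c := c ^ k / (k.factorial : ℝ)) (by positivity)
      convert this using 2 with ξ
      rw [mul_pow]; ring
    · have := h0 ξ
      rw [abs_of_nonneg (by positivity)]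
      gcongr
      exact hle ξ
  refine CosPositive.of_tendsto (B := Real.exp (c * truncLevy α ε 0)) key
    (fun N => Finset.measurable_fun_sum _ fun k _ => ((hm.const_mul c).pow_const k).div_const _)
    (fun N ξ => ?_) fun ξ => ?_
  · have := h0 ξ
    rw [abs_of_nonneg (Finset.sum_nonneg fun k _ => by positivity)]
    exact (Real.sum_le_exp_of_nonneg (by positivity) N).trans
      (Real.exp_le_exp.2 (by gcongr; exact hle ξ))
  · rw [Real.exp_eq_exp_ℝ]
    exact (NormedSpace.expSeries_div_hasSum_exp (c * truncLevy α ε (‖ξ‖ ^ 2))).tendsto_sum_nat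

/-- Near zero `1 - e^{-sr} ≤ sr` leaves `s^{-α}`, integrable since `α < 1`; beyond one the bound is
`s^{-1-α}`. -/
lemma integrableOn_one_sub_exp_mul_levy {α r : ℝ} (hα : 0 < α) (hα1 : α < 1) (hr : 0 ≤ r) :
    IntegrableOn (fun s : ℝ => (1 - Real.exp (-s * r)) * s ^ (-1 - α)) (Ioi 0) := by
  have hm : AEStronglyMeasurable (fun s : ℝ => (1 - Real.exp (-s * r)) * s ^ (-1 - α)) :=
    Measurable.aestronglyMeasurable (by fun_prop)
  rw [← Ioc_union_Ioi_eq_Ioi zero_le_one]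
  refine IntegrableOn.union ?_ ?_
  · have h := (intervalIntegral.intervalIntegrable_rpow' (a := 0) (b := 1) (r := -α)
      (by linarith)).1.const_mul r
    refine h.mono' hm.restrict ((ae_restrict_iff' measurableSet_Ioc).2
      (Eventually.of_forall fun s hs => ?_))
    have h1 : Real.exp (-s * r) ≤ 1 := Real.exp_le_one_iff.2 (by nlinarith [mul_nonneg hs.1.le hr])
    have h2 : 1 - Real.exp (-s * r) ≤ s * r := by linarith [Real.add_one_le_exp (-s * r)]
    have hs0 := hs.1
    rw [Real.norm_eq_abs, abs_of_nonneg (mul_nonneg (by linarith) (by positivity))]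
    calc _ ≤ (s * r) * s ^ (-1 - α) := by gcongr
      _ = r * (s ^ (1 : ℝ) * s ^ (-1 - α)) := by rw [Real.rpow_one]; ring
      _ = _ := by rw [← Real.rpow_add hs0]; ring_nf
  · refine (integrableOn_levy hα one_pos).mono' hm.restrict
      ((ae_restrict_iff' measurableSet_Ioi).2 (Eventually.of_forall fun s hs => ?_))
    have hs0 : (0 : ℝ) < s := one_pos.trans hs
    have h1 : Real.exp (-s * r) ≤ 1 := Real.exp_le_one_iff.2 (by nlinarith [mul_nonneg hs0.le hr])
    rw [Real.norm_eq_abs, abs_of_nonneg (mul_nonneg (by linarith) (by positivity))]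
    exact mul_le_of_le_one_left (by positivity) (by linarith [Real.exp_pos (-s * r)])

/-- The normalizing constant in `r ^ α = c ∫ (1 - exp (-s r)) s^{-1-α} ds`. -/
def levyConst (α : ℝ) : ℝ := ∫ s in Ioi (0 : ℝ), (1 - Real.exp (-s)) * s ^ (-1 - α)

lemma levyConst_pos {α : ℝ} (hα : 0 < α) (hα1 : α < 1) : 0 < levyConst α := by
  have hi := integrableOn_one_sub_exp_mul_levy hα hα1 zero_le_one
  simp only [mul_one] at hi
  have hpos : ∀ s ∈ Ioi (0 : ℝ), 0 < (1 - Real.exp (-s)) * s ^ (-1 - α) := fun s hs => by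
    have hs : 0 < s := hs
    have : Real.exp (-s) < 1 := by simpa using hs
    exact mul_pos (by linarith) (by positivity)
  rw [levyConst, setIntegral_pos_iff_support_of_nonneg_ae _ hi]
  · have : Ioi (0 : ℝ) ⊆ Function.support (fun s => (1 - Real.exp (-s)) * s ^ (-1 - α)) ∩ Ioi 0 :=
      fun s hs => ⟨(hpos s hs).ne', hs⟩
    exact lt_of_lt_of_le (by simp) (measure_mono this)
  · exact (ae_restrict_iff' measurableSet_Ioi).2 (Eventually.of_forall fun s hs => (hpos s hs).le)

lemma integral_one_sub_exp_mul_levy {α r : ℝ} (hα : 0 < α) (hr : 0 ≤ r) :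
    ∫ s in Ioi (0 : ℝ), (1 - Real.exp (-s * r)) * s ^ (-1 - α) = levyConst α * r ^ α := by
  rcases hr.eq_or_lt with rfl | hr
  · simp [Real.zero_rpow hα.ne']
  have h := integral_comp_mul_right_Ioi
    (fun s : ℝ => (1 - Real.exp (-s)) * s ^ (-1 - α)) 0 hr
  rw [zero_mul, smul_eq_mul] at h
  have e : ∀ s ∈ Ioi (0 : ℝ), (1 - Real.exp (-s * r)) * s ^ (-1 - α) =
      r ^ (1 + α) * ((1 - Real.exp (-(s * r))) * (s * r) ^ (-1 - α)) := by
    intro s hs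
    have hs : 0 < s := hs
    rw [Real.mul_rpow hs.le hr.le]
    have : r ^ (1 + α) * r ^ (-1 - α) = 1 := by
      rw [← Real.rpow_add hr]; simp
    rw [neg_mul]
    linear_combination (-(1 - Real.exp (-(s * r))) * s ^ (-1 - α)) * this
  rw [setIntegral_congr_fun measurableSet_Ioi e, integral_const_mul, h, levyConst]
  rw [Real.rpow_add hr, Real.rpow_one]
  field_simp

/-- With `α = β/2`, cutting the Lévy integral at `s > ε` splits the exponent into the finite
constant `-c · truncLevy α ε 0` and a positive term to which `CosPositive.exp_truncLevy` applies.
The cut is removed as `ε → 0`. -/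
lemma CosPositive.exp_neg_rpow {n : ℕ} {β : ℝ} (hβ0 : 0 < β) (hβ2 : β < 2) :
    CosPositive (fun ξ : E n => Real.exp (-‖ξ‖ ^ β)) := by
  have hα : 0 < β / 2 := by linarith
  have hα1 : β / 2 < 1 := by linarith
  set α := β / 2 with hαdef
  have hI := levyConst_pos hα hα1
  set c := (levyConst α)⁻¹ with hc
  have hc0 : 0 < c := inv_pos.2 hI
  set ε : ℕ → ℝ := fun k => 1 / ((k : ℝ) + 1) with hεdef
  have hε : ∀ k, 0 < ε k := fun k => by positivity
  refine CosPositive.of_tendsto (B := 1) (h := fun k ξ => Real.exp (-(c * truncLevy α (ε k) 0)) *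
    Real.exp (c * truncLevy α (ε k) (‖ξ‖ ^ 2)))
    (fun k => (CosPositive.exp_truncLevy hα (hε k) hc0.le).const_mul (Real.exp_pos _).le)
    (fun k => ?_) (fun k ξ => ?_) fun ξ => ?_
  · have := (measurable_truncLevy α (ε k)).comp
      (measurable_norm.pow_const 2 : Measurable fun ξ : E n => ‖ξ‖ ^ 2)
    exact ((this.const_mul c).exp).const_mul _
  · rw [← Real.exp_add, Real.abs_exp, Real.exp_le_one_iff]
    have := mul_le_mul_of_nonneg_left
      (truncLevy_le hα (hε k) (sq_nonneg ‖ξ‖)) hc0.le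
    linarith
  · have hr : 0 ≤ ‖ξ‖ ^ 2 := sq_nonneg _
    have hun : (⋃ k, Ioi (ε k)) = Ioi 0 := by
      ext s
      simp only [mem_iUnion, mem_Ioi]
      exact ⟨fun ⟨k, hk⟩ => (hε k).trans hk, fun hs => exists_nat_one_div_lt hs⟩
    have hmono : Monotone fun k => Ioi (ε k) := fun i j hij =>
      Ioi_subset_Ioi (one_div_le_one_div_of_le (by positivity) (by gcongr))
    have hint := integrableOn_one_sub_exp_mul_levy hα hα1 hr
    have ht := tendsto_setIntegral_of_monotone (fun k => measurableSet_Ioi) hmono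
      (by rw [hun]; exact hint)
    rw [hun, integral_one_sub_exp_mul_levy hα hr] at ht
    have ht2 := (Real.continuous_exp.tendsto _).comp ((ht.const_mul c).neg)
    have hpow : (‖ξ‖ ^ 2) ^ α = ‖ξ‖ ^ β := by
      rw [← Real.rpow_natCast, ← Real.rpow_mul (norm_nonneg _), hαdef]
      congr 1
      push_cast
      ring
    have e1 : -(c * (levyConst α * (‖ξ‖ ^ 2) ^ α)) = -‖ξ‖ ^ β := by
      rw [hpow, hc, inv_mul_cancel_left₀ hI.ne']
    rw [e1] at ht2
    refine ht2.congr fun k => ?_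
    simp only [Function.comp]
    rw [← Real.exp_add]
    congr 1
    have e2 : ∫ s in Ioi (ε k), (1 - Real.exp (-s * ‖ξ‖ ^ 2)) * s ^ (-1 - α) =
        truncLevy α (ε k) 0 - truncLevy α (ε k) (‖ξ‖ ^ 2) := by
      rw [truncLevy, truncLevy, ← integral_sub (integrableOn_exp_mul_levy hα (hε k) le_rfl)
        (integrableOn_exp_mul_levy hα (hε k) hr)]
      simp [sub_mul]
    rw [e2]
    ring

/-! ### Bounds, positivity and total mass of the fundamental solution at time one -/

lemma integrable_exp_neg_rpow {n : ℕ} (hn : 1 ≤ n) {β : ℝ} (hβ0 : 0 < β) :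
    Integrable (fun ξ : E n => Real.exp (-‖ξ‖ ^ β)) := by
  have : Nonempty (Fin n) := ⟨⟨0, hn⟩⟩
  rw [integrable_fun_norm_addHaar (volume : Measure (E n)) (f := fun r => Real.exp (-r ^ β))]
  refine (integrableOn_rpow_mul_exp_neg_rpow (s := ((n - 1 : ℕ) : ℝ)) ?_ hβ0).congr_fun
    (fun r _ => ?_) measurableSet_Ioi
  · have : (0 : ℝ) ≤ ((n - 1 : ℕ) : ℝ) := by positivity
    linarith
  · simp [Real.rpow_natCast]

lemma kernel_one_eq {n : ℕ} (hn : 1 ≤ n) {β : ℝ} (hβ0 : 0 < β) (x : E n) :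
    kernel β 1 x = ((2 * Real.pi) ^ n)⁻¹ *
      ∫ ξ : E n, Real.cos (inner ℝ x ξ) * Real.exp (-‖ξ‖ ^ β) := by
  have hexp : ∀ ξ : E n, Complex.exp (Complex.I * ((inner ℝ x ξ : ℝ) : ℂ) -
      ((1 * ‖ξ‖ ^ β : ℝ) : ℂ)) =
      Complex.exp (((inner ℝ x ξ : ℝ) : ℂ) * Complex.I) * ((Real.exp (-‖ξ‖ ^ β) : ℝ) : ℂ) := by
    intro ξ
    rw [Complex.ofReal_exp, ← Complex.exp_add]
    congr 1
    push_cast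
    ring
  have hi : Integrable fun ξ : E n => Complex.exp (((inner ℝ x ξ : ℝ) : ℂ) * Complex.I) *
      ((Real.exp (-‖ξ‖ ^ β) : ℝ) : ℂ) :=
    (integrable_exp_neg_rpow hn hβ0).ofReal.bdd_mul (c := 1)
      (Continuous.aestronglyMeasurable (by fun_prop))
      (Eventually.of_forall fun ξ => (Complex.norm_exp_ofReal_mul_I _).le)
  rw [kernel]
  simp only [hexp]
  have h3 := Complex.reCLM.integral_comp_comm hi
  simp only [Complex.reCLM_apply] at h3
  rw [← h3]
  congr 2 with ξ
  rw [Complex.re_mul_ofReal, Complex.exp_ofReal_mul_I_re]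

/-- The auxiliary Gaussian is removed by letting its parameter tend to zero; now `e^{-|ξ|^β}` itself
is integrable and dominates. -/
lemma kernel_one_nonneg {n : ℕ} (hn : 1 ≤ n) {β : ℝ} (hβ0 : 0 < β) (hβ2 : β < 2) (x : E n) :
    0 ≤ kernel β 1 x := by
  rw [kernel_one_eq hn hβ0]
  refine mul_nonneg (by positivity) ?_
  have hint := integrable_exp_neg_rpow hn hβ0
  refine ge_of_tendsto' (f := fun k : ℕ => ∫ ξ : E n, Real.cos (inner ℝ x ξ) *
    (Real.exp (-‖ξ‖ ^ β) * Real.exp (-(1 / ((k : ℝ) + 1)) * ‖ξ‖ ^ 2))) (x := atTop) ?_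
    fun k => CosPositive.exp_neg_rpow hβ0 hβ2 _ (by positivity) x
  have hle : ∀ (k : ℕ) (ξ : E n), Real.exp (-(1 / ((k : ℝ) + 1)) * ‖ξ‖ ^ 2) ≤ 1 := fun k ξ =>
    Real.exp_le_one_iff.2 (by
      rw [neg_mul]
      exact neg_nonpos.2 (by positivity))
  refine tendsto_integral_of_dominated_convergence (fun ξ => Real.exp (-‖ξ‖ ^ β))
    (fun k => Measurable.aestronglyMeasurable (by fun_prop)) hint
    (fun k => Eventually.of_forall fun ξ => ?_) (Eventually.of_forall fun ξ => ?_)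
  · rw [norm_mul, norm_mul, Real.norm_eq_abs, Real.norm_eq_abs, Real.norm_eq_abs, Real.abs_exp,
      Real.abs_exp]
    calc _ ≤ 1 * (Real.exp (-‖ξ‖ ^ β) * 1) := by
          gcongr
          · exact Real.abs_cos_le_one _
          · exact hle k ξ
      _ = _ := by ring
  · have h1 : Tendsto (fun k : ℕ => -(1 / ((k : ℝ) + 1)) * ‖ξ‖ ^ 2) atTop (𝓝 (-0 * ‖ξ‖ ^ 2)) :=
      (tendsto_one_div_add_atTop_nhds_zero_nat.neg).mul_const _
    have h2 := (Real.continuous_exp.tendsto _).comp h1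
    simp only [neg_zero, zero_mul, Real.exp_zero] at h2
    simpa using (h2.const_mul (Real.exp (-‖ξ‖ ^ β))).const_mul (Real.cos (inner ℝ x ξ))

lemma kernel_one_le {n : ℕ} (hn : 1 ≤ n) {β : ℝ} (hβ0 : 0 < β) (x : E n) :
    kernel β 1 x ≤ ((2 * Real.pi) ^ n)⁻¹ * ∫ ξ : E n, Real.exp (-‖ξ‖ ^ β) := by
  rw [kernel_one_eq hn hβ0]
  have hint := integrable_exp_neg_rpow hn hβ0
  refine mul_le_mul_of_nonneg_left (integral_mono (integrable_cos_mul x hint) hint fun ξ => ?_)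
    (by positivity)
  exact mul_le_of_le_one_left (Real.exp_pos _).le (Real.cos_le_one _)

lemma measurable_kernel_one {n : ℕ} (hn : 1 ≤ n) {β : ℝ} (hβ0 : 0 < β) :
    Measurable (kernel β 1 : E n → ℝ) := by
  have : StronglyMeasurable fun q : E n × E n =>
      Real.cos (inner ℝ q.1 q.2) * Real.exp (-‖q.2‖ ^ β) :=
    Measurable.stronglyMeasurable (by fun_prop)
  have h2 := (this.integral_prod_right' (ν := volume)).measurable.const_mul ((2 * Real.pi) ^ n)⁻¹
  rw [funext (kernel_one_eq hn hβ0)]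
  exact h2

/-- Fubini moves the Fourier integral onto the Gaussian. The parameter `ρ²/4` is chosen so that the
transform is a multiple of `e^{-|ξ|²/ρ²}`, which `ξ = ρη` turns into a Gaussian independent of `ρ`.
-/
lemma integral_kernel_one_mul_gaussian {n : ℕ} (hn : 1 ≤ n) {β : ℝ} (hβ0 : 0 < β) {ρ : ℝ}
    (hρ : 0 < ρ) :
    ∫ x : E n, kernel β 1 x * Real.exp (-(ρ ^ 2 / 4) * ‖x‖ ^ 2) =
      (Real.pi ^ (n / 2 : ℝ))⁻¹ *
        ∫ η : E n, Real.exp (-(ρ * ‖η‖) ^ β) * Real.exp (-1 * ‖η‖ ^ 2) := by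
  have hδ : 0 < ρ ^ 2 / 4 := by positivity
  have hint := integrable_exp_neg_rpow hn hβ0
  have e1 : ∀ x : E n, kernel β 1 x * Real.exp (-(ρ ^ 2 / 4) * ‖x‖ ^ 2) =
      ((2 * Real.pi) ^ n)⁻¹ * ∫ ξ : E n, Real.exp (-‖ξ‖ ^ β) *
        (Real.cos (inner ℝ ξ x) * Real.exp (-(ρ ^ 2 / 4) * ‖x‖ ^ 2)) := by
    intro x
    rw [kernel_one_eq hn hβ0, mul_assoc, ← integral_mul_const]
    congr 2 with ξ
    rw [real_inner_comm]
    ring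
  simp only [e1, integral_const_mul]
  rw [integral_integral_swap]
  · simp only [integral_const_mul, integral_cos_mul_gaussian hδ]
    have e2 : ∀ ξ : E n, Real.exp (-‖ξ‖ ^ β) * ((Real.pi / (ρ ^ 2 / 4)) ^ (n / 2 : ℝ) *
        Real.exp (-‖ξ‖ ^ 2 / (4 * (ρ ^ 2 / 4)))) = (Real.pi / (ρ ^ 2 / 4)) ^ (n / 2 : ℝ) *
        (fun η : E n => Real.exp (-(ρ * ‖η‖) ^ β) * Real.exp (-1 * ‖η‖ ^ 2)) (ρ⁻¹ • ξ) := by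
      intro ξ
      simp only [norm_smul, norm_inv, Real.norm_eq_abs, abs_of_pos hρ]
      rw [mul_inv_cancel_left₀ hρ.ne']
      have : -‖ξ‖ ^ 2 / (4 * (ρ ^ 2 / 4)) = -1 * (ρ⁻¹ * ‖ξ‖) ^ 2 := by
        field_simp
      rw [this]
      ring
    have e5 := Measure.integral_comp_inv_smul_of_nonneg (volume : Measure (E n))
      (fun η : E n => Real.exp (-(ρ * ‖η‖) ^ β) * Real.exp (-1 * ‖η‖ ^ 2)) hρ.le
    simp only [e2, integral_const_mul]
    rw [e5, smul_eq_mul, ← mul_assoc, ← mul_assoc,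
      finrank_euclideanSpace_fin]
    congr 1
    have e3 : (Real.pi / (ρ ^ 2 / 4)) ^ (n / 2 : ℝ) =
        Real.pi ^ (n / 2 : ℝ) * (2 / ρ) ^ n := by
      have : Real.pi / (ρ ^ 2 / 4) = Real.pi * (2 / ρ) ^ 2 := by field_simp; norm_num
      rw [this, Real.mul_rpow Real.pi_pos.le (by positivity)]
      congr 1
      rw [← Real.rpow_natCast, ← Real.rpow_mul (by positivity), ← Real.rpow_natCast]
      congr 1
      push_cast
      ring
    have e4 : (Real.pi ^ (n / 2 : ℝ)) * Real.pi ^ (n / 2 : ℝ) = Real.pi ^ n := by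
      rw [← Real.rpow_add Real.pi_pos, ← Real.rpow_natCast]
      ring_nf
    rw [e3, mul_pow, div_pow, ← e4]
    have := Real.rpow_pos_of_pos Real.pi_pos (n / 2 : ℝ)
    field_simp
  · have i1 := (integrable_gaussian (n := n) hδ).mul_prod hint
    refine i1.mono (Measurable.aestronglyMeasurable (by fun_prop))
      (Eventually.of_forall fun q => ?_)
    simp only [Function.uncurry, norm_mul]
    have : ‖Real.cos (inner ℝ q.2 q.1)‖ ≤ 1 := Real.abs_cos_le_one _
    calc _ ≤ ‖Real.exp (-‖q.2‖ ^ β)‖ * (1 * ‖Real.exp (-(ρ ^ 2 / 4) * ‖q.1‖ ^ 2)‖) := by gcongr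
      _ = _ := by ring

/-- Let `ρ → 0` in `integral_kernel_one_mul_gaussian`: the left side converges monotonically because
the density is nonnegative, the right side by domination. Neither Fourier inversion nor prior
integrability of the density is needed. -/
lemma lintegral_kernel_one {n : ℕ} (hn : 1 ≤ n) {β : ℝ} (hβ0 : 0 < β) (hβ2 : β < 2) :
    ∫⁻ x : E n, ENNReal.ofReal (kernel β 1 x) = 1 := by
  have hK := kernel_one_nonneg (n := n) hn hβ0 hβ2
  have hm := measurable_kernel_one (n := n) hn hβ0
  set ρ : ℕ → ℝ := fun k => 1 / ((k : ℝ) + 1) with hρdef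
  have hρ : ∀ k, 0 < ρ k := fun k => by positivity
  have hρ0 : Tendsto ρ atTop (𝓝 0) := tendsto_one_div_add_atTop_nhds_zero_nat
  have hanti : Antitone ρ := fun i j hij => one_div_le_one_div_of_le (by positivity) (by gcongr)
  have hlim : Tendsto (fun k => ∫⁻ x : E n, ENNReal.ofReal
      (kernel β 1 x * Real.exp (-(ρ k ^ 2 / 4) * ‖x‖ ^ 2))) atTop
      (𝓝 (∫⁻ x : E n, ENNReal.ofReal (kernel β 1 x))) := by
    refine lintegral_tendsto_of_tendsto_of_monotone
      (fun k => Measurable.aemeasurable (by fun_prop))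
      (Eventually.of_forall fun x i j hij => ENNReal.ofReal_le_ofReal
        (mul_le_mul_of_nonneg_left (Real.exp_le_exp.2 ?_) (hK x)))
      (Eventually.of_forall fun x => ?_)
    · have := hanti hij
      have h0 := (hρ j).le
      gcongr
    · refine (ENNReal.continuous_ofReal.tendsto _).comp ?_
      have h1 : Tendsto (fun k => -(ρ k ^ 2 / 4) * ‖x‖ ^ 2) atTop
          (𝓝 (-((0 : ℝ) ^ 2 / 4) * ‖x‖ ^ 2)) :=
        (((hρ0.pow 2).div_const 4).neg).mul_const _
      have h2 := (Real.continuous_exp.tendsto _).comp h1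
      simp only [ne_eq, OfNat.ofNat_ne_zero, not_false_eq_true, zero_pow, zero_div, neg_zero,
        zero_mul, Real.exp_zero] at h2
      simpa using h2.const_mul (kernel β 1 x)
  have hlim2 : Tendsto (fun k => ∫ η : E n, Real.exp (-(ρ k * ‖η‖) ^ β) *
      Real.exp (-1 * ‖η‖ ^ 2)) atTop (𝓝 (∫ η : E n, 1 * Real.exp (-1 * ‖η‖ ^ 2))) := by
    refine tendsto_integral_of_dominated_convergence (fun η => Real.exp (-1 * ‖η‖ ^ 2))
      (fun k => Measurable.aestronglyMeasurable (by fun_prop)) (integrable_gaussian one_pos)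
      (fun k => Eventually.of_forall fun η => ?_) (Eventually.of_forall fun η => ?_)
    · rw [norm_mul, Real.norm_eq_abs, Real.norm_eq_abs, Real.abs_exp, Real.abs_exp]
      refine mul_le_of_le_one_left (Real.exp_pos _).le (Real.exp_le_one_iff.2 ?_)
      have := (hρ k).le
      exact neg_nonpos.2 (by positivity)
    · refine Tendsto.mul_const _ ?_
      have h1 : Tendsto (fun k => -(ρ k * ‖η‖) ^ β) atTop (𝓝 (-((0 : ℝ) * ‖η‖) ^ β)) :=
        ((hρ0.mul_const ‖η‖).rpow_const (Or.inr hβ0.le)).neg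
      have h2 := (Real.continuous_exp.tendsto _).comp h1
      simpa [Function.comp_def, Real.zero_rpow hβ0.ne'] using h2
  have hgauss : ∫ η : E n, 1 * Real.exp (-1 * ‖η‖ ^ 2) = Real.pi ^ (n / 2 : ℝ) := by
    have := GaussianFourier.integral_rexp_neg_mul_sq_norm (V := E n) (b := 1) one_pos
    simpa using this
  have hbd : ∀ x : E n, |kernel β 1 x| ≤
      ((2 * Real.pi) ^ n)⁻¹ * ∫ ξ : E n, Real.exp (-‖ξ‖ ^ β) := fun x => by
    rw [abs_of_nonneg (hK x)]
    exact kernel_one_le hn hβ0 x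
  refine tendsto_nhds_unique hlim ?_
  have h3 := hlim2.const_mul (Real.pi ^ (n / 2 : ℝ))⁻¹
  rw [hgauss, inv_mul_cancel₀ (Real.rpow_pos_of_pos Real.pi_pos _).ne'] at h3
  have h4 := (ENNReal.continuous_ofReal.tendsto _).comp h3
  rw [ENNReal.ofReal_one] at h4
  refine h4.congr fun k => ?_
  have hδ : 0 < ρ k ^ 2 / 4 := by have := hρ k; positivity
  simp only [Function.comp]
  rw [← integral_kernel_one_mul_gaussian hn hβ0 (hρ k),
    ofReal_integral_eq_lintegral_ofReal (integrable_bdd_mul_gaussian hm hbd hδ)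
      (Eventually.of_forall fun x => mul_nonneg (hK x) (Real.exp_pos _).le)]

/-! ### Scaling in time and the semigroup as an average over translates -/

lemma kernel_scaling {n : ℕ} {β t : ℝ} (hβ0 : 0 < β) (ht : 0 < t) (x : E n) :
    kernel β t x = ((t ^ (1 / β)) ^ n)⁻¹ * kernel β 1 ((t ^ (1 / β))⁻¹ • x) := by
  have hr : 0 < t ^ (1 / β) := by positivity
  have hrβ : (t ^ (1 / β)) ^ β = t := by
    rw [← Real.rpow_mul ht.le, one_div_mul_cancel hβ0.ne', Real.rpow_one]
  set r := t ^ (1 / β)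
  have e : ∀ ξ : E n, Complex.exp (Complex.I * ((inner ℝ x ξ : ℝ) : ℂ) -
      ((t * ‖ξ‖ ^ β : ℝ) : ℂ)) = (fun ζ : E n => Complex.exp (Complex.I *
        ((inner ℝ (r⁻¹ • x) ζ : ℝ) : ℂ) - ((1 * ‖ζ‖ ^ β : ℝ) : ℂ))) (r • ξ) := by
    intro ξ
    simp only
    rw [real_inner_smul_left, real_inner_smul_right, inv_mul_cancel_left₀ hr.ne', norm_smul,
      Real.norm_eq_abs, abs_of_pos hr, Real.mul_rpow hr.le (norm_nonneg _), hrβ, one_mul]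
  have e' := Measure.integral_comp_smul_of_nonneg (volume : Measure (E n))
    (fun ζ : E n => Complex.exp (Complex.I * ((inner ℝ (r⁻¹ • x) ζ : ℝ) : ℂ) -
      ((1 * ‖ζ‖ ^ β : ℝ) : ℂ))) r (hR := hr.le)
  rw [kernel, kernel]
  simp only [e]
  rw [e', finrank_euclideanSpace_fin,
    Complex.smul_re, smul_eq_mul]
  ring

/-- The probability measure with density `S_β(·, 1)`. -/
def stableLaw (n : ℕ) (β : ℝ) : Measure (E n) :=
  volume.withDensity fun z => ENNReal.ofReal (kernel β 1 z)

lemma isProbabilityMeasure_stableLaw {n : ℕ} (hn : 1 ≤ n) {β : ℝ} (hβ0 : 0 < β) (hβ2 : β < 2) :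
    IsProbabilityMeasure (stableLaw n β) :=
  ⟨by rw [stableLaw, withDensity_apply _ MeasurableSet.univ, setLIntegral_univ,
    lintegral_kernel_one hn hβ0 hβ2]⟩

lemma exists_stableLaw_le {n : ℕ} (hn : 1 ≤ n) {β : ℝ} (hβ0 : 0 < β) :
    ∃ c : ℝ, 0 ≤ c ∧ stableLaw n β ≤ ENNReal.ofReal c • (volume : Measure (E n)) := by
  refine ⟨((2 * Real.pi) ^ n)⁻¹ * ∫ ξ : E n, Real.exp (-‖ξ‖ ^ β),
    mul_nonneg (by positivity) (integral_nonneg fun ξ => (Real.exp_pos _).le), ?_⟩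
  rw [← withDensity_const]
  exact withDensity_mono
    (Eventually.of_forall fun z => ENNReal.ofReal_le_ofReal (kernel_one_le hn hβ0 z))

/-- The average of `g` over the translates `x - t^{1/β} z`, `z` distributed according to `P`. -/
def avg {n : ℕ} (P : Measure (E n)) (β t : ℝ) (g : E n → ℝ) (x : E n) : ℝ :=
  ∫ z, g (x - t ^ (1 / β) • z) ∂P

lemma semigroup_eq_avg {n : ℕ} (hn : 1 ≤ n) {β t : ℝ} (hβ0 : 0 < β) (hβ2 : β < 2) (ht : 0 ≤ t)
    (g : E n → ℝ) (x : E n) : semigroup β t g x = avg (stableLaw n β) β t g x := by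
  have := isProbabilityMeasure_stableLaw hn hβ0 hβ2
  rcases ht.eq_or_lt with rfl | ht
  -- At `t = 0` the dilation factor `0 ^ (1/β)` is zero, so the average is `g x` because `P` has
  -- mass one.
  · simp [semigroup, avg, Real.zero_rpow (inv_pos.2 hβ0).ne']
  have hr : 0 < t ^ (1 / β) := by positivity
  rw [semigroup, if_neg ht.ne', avg, stableLaw,
    integral_withDensity_eq_integral_toReal_smul
      (measurable_kernel_one hn hβ0).ennreal_ofReal
      (Eventually.of_forall fun z => ENNReal.ofReal_lt_top)]
  rw [← integral_sub_left_eq_self _ volume x]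
  simp only [sub_sub_cancel]
  simp only [kernel_scaling hβ0 ht, ENNReal.toReal_ofReal (kernel_one_nonneg hn hβ0 hβ2 _)]
  set r := t ^ (1 / β)
  have h := Measure.integral_comp_inv_smul_of_nonneg (volume : Measure (E n))
    (fun z => kernel β 1 z * g (x - r • z)) hr.le
  simp only [smul_inv_smul₀ hr.ne', finrank_euclideanSpace_fin, smul_eq_mul] at h
  simp only [mul_assoc, integral_const_mul, h, smul_eq_mul]
  rw [inv_mul_cancel_left₀ (by positivity)]

/-! ### Exponential integrals -/

/-- The exponential integral `∫ (exp (μ |u|^p) - 1) dx`. -/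
def expInt {n : ℕ} (p μ : ℝ) (u : E n → ℝ) : ℝ≥0∞ :=
  ∫⁻ x, ENNReal.ofReal (Real.exp (μ * |u x| ^ p) - 1)

/-- The integral `∫ |w|^p dx`. -/
def lpInt {n : ℕ} (p : ℝ) (w : E n → ℝ) : ℝ≥0∞ := ∫⁻ x, ‖w x‖ₑ ^ p

lemma enorm_rpow_eq_ofReal {p : ℝ} (hp : 0 ≤ p) (y : ℝ) : ‖y‖ₑ ^ p = ENNReal.ofReal (|y| ^ p) := by
  rw [Real.enorm_eq_ofReal_abs, ENNReal.ofReal_rpow_of_nonneg (abs_nonneg _) hp]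

lemma modular_eq_expInt {n : ℕ} (p l : ℝ) (u : E n → ℝ) :
    modular p u l = expInt p (l ^ p)⁻¹ u := by
  simp only [modular, expInt, div_eq_inv_mul]

lemma expInt_mono {n : ℕ} {p μ μ' : ℝ} (h : μ ≤ μ') (u : E n → ℝ) :
    expInt p μ u ≤ expInt p μ' u := by
  refine lintegral_mono fun x => ENNReal.ofReal_le_ofReal ?_
  gcongr

lemma expInt_congr {n : ℕ} {p μ : ℝ} {u v : E n → ℝ} (h : u =ᵐ[volume] v) :
    expInt p μ u = expInt p μ v :=
  lintegral_congr_ae (h.mono fun x hx => by simp only [hx])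

lemma expInt_sub_comm {n : ℕ} {p μ : ℝ} (u v : E n → ℝ) :
    expInt p μ (fun x => u x - v x) = expInt p μ (fun x => v x - u x) := by
  simp only [expInt, abs_sub_comm]

lemma measurable_expInt_integrand {n : ℕ} (p μ : ℝ) {u : E n → ℝ} (hu : Measurable u) :
    Measurable fun x => ENNReal.ofReal (Real.exp (μ * |u x| ^ p) - 1) := by
  fun_prop

lemma abs_add_rpow_le_max {p : ℝ} (hp : 0 ≤ p) (a b : ℝ) :
    |a + b| ^ p ≤ max (2 ^ p * |a| ^ p) (2 ^ p * |b| ^ p) := by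
  rcases le_total |a| |b| with h | h
  · refine le_max_of_le_right ?_
    rw [← Real.mul_rpow zero_le_two (abs_nonneg b)]
    exact Real.rpow_le_rpow (abs_nonneg _) (by linarith [abs_add_le a b]) hp
  · refine le_max_of_le_left ?_
    rw [← Real.mul_rpow zero_le_two (abs_nonneg a)]
    exact Real.rpow_le_rpow (abs_nonneg _) (by linarith [abs_add_le a b]) hp

/-- The exponential of a maximum is one of the two exponentials, so no product term appears; the
price is the factor `2^p` in the rate. -/
lemma exp_abs_add_rpow_sub_one_le {p μ : ℝ} (hp : 0 ≤ p) (hμ : 0 ≤ μ) (a b : ℝ) :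
    Real.exp (μ * |a + b| ^ p) - 1 ≤
      (Real.exp (μ * 2 ^ p * |a| ^ p) - 1) + (Real.exp (μ * 2 ^ p * |b| ^ p) - 1) := by
  have ha : 1 ≤ Real.exp (μ * 2 ^ p * |a| ^ p) := Real.one_le_exp (by positivity)
  have hb : 1 ≤ Real.exp (μ * 2 ^ p * |b| ^ p) := Real.one_le_exp (by positivity)
  have h := mul_le_mul_of_nonneg_left (abs_add_rpow_le_max hp a b) hμ
  rcases max_choice (2 ^ p * |a| ^ p) (2 ^ p * |b| ^ p) with e | e <;> rw [e, ← mul_assoc] at h <;>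
    have := Real.exp_le_exp.2 h <;> linarith

/-- For bounded `b` the contribution of `b` is linear in `|b|^p`, through `e^Y - 1 ≤ Y e^Y`. This
lets an `L^p` norm control a bounded perturbation. -/
lemma exp_abs_add_rpow_sub_one_le_of_abs_le {p μ M : ℝ} (hp : 0 ≤ p) (hμ : 0 ≤ μ) (a : ℝ) {b : ℝ}
    (hb : |b| ≤ M) :
    Real.exp (μ * |a + b| ^ p) - 1 ≤ Real.exp (μ * 2 ^ p * M ^ p) *
      ((Real.exp (μ * 2 ^ p * |a| ^ p) - 1) + μ * 2 ^ p * |b| ^ p) := by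
  set X := μ * 2 ^ p * |a| ^ p with hX
  set Y := μ * 2 ^ p * |b| ^ p with hY
  have hX0 : 0 ≤ X := by positivity
  have hY0 : 0 ≤ Y := by positivity
  have h1 : μ * |a + b| ^ p ≤ X + Y := by
    have h := mul_le_mul_of_nonneg_left (abs_add_rpow_le_max hp a b) hμ
    have h2 : max (2 ^ p * |a| ^ p) (2 ^ p * |b| ^ p) ≤ 2 ^ p * |a| ^ p + 2 ^ p * |b| ^ p :=
      max_le_add_of_nonneg (by positivity) (by positivity)
    have h3 := mul_le_mul_of_nonneg_left h2 hμ
    rw [hX, hY]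
    linarith
  have hYM : Y ≤ μ * 2 ^ p * M ^ p := by
    rw [hY]
    gcongr
  have h2 : Real.exp Y - 1 ≤ Real.exp Y * Y := by
    have := Real.add_one_le_exp (-Y)
    have h4 : Real.exp Y * Real.exp (-Y) = 1 := by rw [← Real.exp_add]; simp
    nlinarith [Real.exp_pos Y]
  have hX1 : 0 ≤ Real.exp X - 1 := by linarith [Real.one_le_exp hX0]
  calc Real.exp (μ * |a + b| ^ p) - 1 ≤ Real.exp (X + Y) - 1 := by gcongr
    _ = Real.exp Y * (Real.exp X - 1) + (Real.exp Y - 1) := by rw [Real.exp_add]; ring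
    _ ≤ Real.exp Y * (Real.exp X - 1) + Real.exp Y * Y := by gcongr
    _ = Real.exp Y * ((Real.exp X - 1) + Y) := by ring
    _ ≤ _ := by gcongr

lemma expInt_add_le {n : ℕ} {p μ : ℝ} (hp : 0 ≤ p) (hμ : 0 ≤ μ) {a b : E n → ℝ}
    (ha : Measurable a) :
    expInt p μ (fun x => a x + b x) ≤ expInt p (μ * 2 ^ p) a + expInt p (μ * 2 ^ p) b := by
  rw [expInt, expInt, expInt, ← lintegral_add_left (measurable_expInt_integrand p _ ha)]
  refine lintegral_mono fun x => ?_
  rw [← ENNReal.ofReal_add]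
  · exact ENNReal.ofReal_le_ofReal (exp_abs_add_rpow_sub_one_le hp hμ _ _)
  · linarith [Real.one_le_exp (show 0 ≤ μ * 2 ^ p * |a x| ^ p by positivity)]
  · linarith [Real.one_le_exp (show 0 ≤ μ * 2 ^ p * |b x| ^ p by positivity)]

lemma expInt_sub_le {n : ℕ} {p μ : ℝ} (hp : 0 ≤ p) (hμ : 0 ≤ μ) {a b : E n → ℝ}
    (ha : Measurable a) :
    expInt p μ (fun x => a x - b x) ≤ expInt p (μ * 2 ^ p) a + expInt p (μ * 2 ^ p) b := by
  have := expInt_add_le hp hμ (b := fun x => -b x) ha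
  simpa only [sub_eq_add_neg, expInt, abs_neg] using this

lemma expInt_add_le_of_abs_le {n : ℕ} {p μ M : ℝ} (hp : 0 ≤ p) (hμ : 0 ≤ μ) {a b : E n → ℝ}
    (ha : Measurable a) (hb : ∀ x, |b x| ≤ M) :
    expInt p μ (fun x => a x + b x) ≤ ENNReal.ofReal (Real.exp (μ * 2 ^ p * M ^ p)) *
      (expInt p (μ * 2 ^ p) a + ENNReal.ofReal (μ * 2 ^ p) * lpInt p b) := by
  have hm := measurable_expInt_integrand p (μ * 2 ^ p) ha
  rw [expInt, expInt, lpInt, ← lintegral_const_mul' _ _ ENNReal.ofReal_ne_top,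
    ← lintegral_add_left hm, ← lintegral_const_mul' _ _ ENNReal.ofReal_ne_top]
  refine lintegral_mono fun x => ?_
  simp only
  have h1 : 0 ≤ Real.exp (μ * 2 ^ p * |a x| ^ p) - 1 := by
    linarith [Real.one_le_exp (show 0 ≤ μ * 2 ^ p * |a x| ^ p by positivity)]
  rw [enorm_rpow_eq_ofReal hp, ← ENNReal.ofReal_mul (by positivity),
    ← ENNReal.ofReal_add h1 (by positivity), ← ENNReal.ofReal_mul (by positivity)]
  exact ENNReal.ofReal_le_ofReal (exp_abs_add_rpow_sub_one_le_of_abs_le hp hμ _ (hb x))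

lemma lpInt_le_expInt {n : ℕ} {p μ : ℝ} (hp : 0 ≤ p) (hμ : 0 < μ) (u : E n → ℝ) :
    ENNReal.ofReal μ * lpInt p u ≤ expInt p μ u := by
  rw [lpInt, expInt, ← lintegral_const_mul' _ _ ENNReal.ofReal_ne_top]
  refine lintegral_mono fun x => ?_
  simp only
  rw [enorm_rpow_eq_ofReal hp, ← ENNReal.ofReal_mul hμ.le]
  refine ENNReal.ofReal_le_ofReal ?_
  linarith [Real.add_one_le_exp (μ * |u x| ^ p)]

lemma lpInt_ne_top_of_expInt {n : ℕ} {p μ : ℝ} (hp : 0 ≤ p) (hμ : 0 < μ) {u : E n → ℝ}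
    (h : expInt p μ u ≠ ⊤) : lpInt p u ≠ ⊤ := by
  intro h2
  have := lpInt_le_expInt hp hμ u
  rw [h2, ENNReal.mul_top (by simpa using hμ), top_le_iff] at this
  exact h this

/-! ### Averages over translates -/

/-- Jensen's inequality for powers on measure spaces of mass at most one. -/
lemma rpow_lintegral_le {α : Type*} [MeasurableSpace α] {μ : Measure α} (hμ : μ univ ≤ 1) {p : ℝ}
    (hp : 1 < p) {f : α → ℝ≥0∞} (hf : AEMeasurable f μ) :
    (∫⁻ a, f a ∂μ) ^ p ≤ ∫⁻ a, f a ^ p ∂μ := by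
  have hp0 : 0 < p := by linarith
  have h := ENNReal.lintegral_mul_le_Lp_mul_Lq μ (Real.HolderConjugate.conjExponent hp) hf
    (g := fun _ => 1) aemeasurable_const
  simp only [Pi.mul_apply, mul_one, ENNReal.one_rpow, lintegral_const, one_mul] at h
  have h2 : (∫⁻ a, f a ∂μ) ≤ (∫⁻ a, f a ^ p ∂μ) ^ (1 / p) := by
    refine h.trans (mul_le_of_le_one_right' (ENNReal.rpow_le_one hμ ?_))
    exact one_div_nonneg.2 (Real.HolderConjugate.conjExponent hp).symm.pos.le
  calc _ ≤ ((∫⁻ a, f a ^ p ∂μ) ^ (1 / p)) ^ p := ENNReal.rpow_le_rpow h2 hp0.le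
    _ = _ := by rw [← ENNReal.rpow_mul, one_div_mul_cancel hp0.ne', ENNReal.rpow_one]

lemma convexOn_exp_abs_rpow {p μ : ℝ} (hp : 1 ≤ p) (hμ : 0 ≤ μ) :
    ConvexOn ℝ univ fun y : ℝ => Real.exp (μ * |y| ^ p) - 1 := by
  refine ⟨convex_univ, fun x _ y _ a b ha hb hab => ?_⟩
  simp only [smul_eq_mul]
  have h1 : |a * x + b * y| ≤ a * |x| + b * |y| := by
    refine (abs_add_le _ _).trans_eq ?_
    rw [abs_mul, abs_mul, abs_of_nonneg ha, abs_of_nonneg hb]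
  have h2 : |a * x + b * y| ^ p ≤ a * |x| ^ p + b * |y| ^ p :=
    (Real.rpow_le_rpow (abs_nonneg _) h1 (by linarith)).trans
      ((convexOn_rpow hp).2 (abs_nonneg x) (abs_nonneg y) ha hb hab)
  have h3 : μ * |a * x + b * y| ^ p ≤ a * (μ * |x| ^ p) + b * (μ * |y| ^ p) := by
    have := mul_le_mul_of_nonneg_left h2 hμ
    linarith
  have h4 := (Real.exp_le_exp.2 h3).trans
    (convexOn_exp.2 (mem_univ (μ * |x| ^ p)) (mem_univ (μ * |y| ^ p)) ha hb hab)
  simp only [smul_eq_mul] at h4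
  linarith

/-- Jensen's inequality, free of integrability hypotheses since both degenerate cases are trivially
true. -/
lemma exp_abs_integral_le {α : Type*} [MeasurableSpace α] {P : Measure α} [IsProbabilityMeasure P]
    {p μ : ℝ} (hp : 1 ≤ p) (hμ : 0 ≤ μ) {v : α → ℝ} (hv : Measurable v) :
    ENNReal.ofReal (Real.exp (μ * |∫ z, v z ∂P| ^ p) - 1) ≤
      ∫⁻ z, ENNReal.ofReal (Real.exp (μ * |v z| ^ p) - 1) ∂P := by
  by_cases hi : Integrable v P
  swap
  -- A non-integrable `v` has integral zero by convention, and the left side is `e^0 - 1 = 0`.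
  · rw [integral_undef hi]
    simp [Real.zero_rpow (by linarith : p ≠ 0)]
  have hnn : ∀ z, 0 ≤ Real.exp (μ * |v z| ^ p) - 1 := fun z => by
    linarith [Real.one_le_exp (show 0 ≤ μ * |v z| ^ p by positivity)]
  have hm : Measurable fun z => Real.exp (μ * |v z| ^ p) - 1 := by fun_prop
  by_cases hj : Integrable (fun z => Real.exp (μ * |v z| ^ p) - 1) P
  · rw [← ofReal_integral_eq_lintegral_ofReal hj (Eventually.of_forall hnn)]
    refine ENNReal.ofReal_le_ofReal ?_
    have hc : Continuous fun y : ℝ => Real.exp (μ * |y| ^ p) - 1 := by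
      have : Continuous fun y : ℝ => |y| ^ p :=
        continuous_abs.rpow_const fun _ => Or.inr (by linarith)
      fun_prop
    exact (convexOn_exp_abs_rpow hp hμ).map_integral_le hc.continuousOn isClosed_univ
      (Eventually.of_forall fun _ => mem_univ _) hi hj
  · have : ∫⁻ z, ENNReal.ofReal (Real.exp (μ * |v z| ^ p) - 1) ∂P = ⊤ := by
      by_contra hne
      exact hj ((lintegral_ofReal_ne_top_iff_integrable hm.aestronglyMeasurable
        (Eventually.of_forall hnn)).1 hne)
    rw [this]
    exact le_top

section avg

variable {n : ℕ} {P : Measure (E n)}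

lemma lintegral_lintegral_sub_smul [IsProbabilityMeasure P] {G : E n → ℝ≥0∞} (hG : Measurable G)
    (r : ℝ) : ∫⁻ x, ∫⁻ z, G (x - r • z) ∂P = ∫⁻ x, G x := by
  rw [lintegral_lintegral_swap (Measurable.aemeasurable (by fun_prop))]
  simp only [lintegral_sub_right_eq_self G, lintegral_const, measure_univ, mul_one]

/-- The `L^1` to `L^∞` estimate: a bounded density dilated by `r` has height of order `r^{-n}`. -/
lemma lintegral_sub_smul_le {c : ℝ} (hP : P ≤ ENNReal.ofReal c • (volume : Measure (E n)))
    {G : E n → ℝ≥0∞} (hG : Measurable G) {r : ℝ} (hr : 0 < r) (x : E n) :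
    ∫⁻ z, G (x - r • z) ∂P ≤ ENNReal.ofReal c * (ENNReal.ofReal (r ^ n)⁻¹ * ∫⁻ y, G y) := by
  refine (lintegral_mono' hP le_rfl).trans ?_
  rw [lintegral_smul_measure, smul_eq_mul]
  gcongr
  have h1 : ∫⁻ z : E n, G (x - r • z) = ∫⁻ y, G (x - y) ∂(Measure.map (r • ·) volume) :=
    (lintegral_map (f := fun y => G (x - y)) (by fun_prop) (measurable_const_smul r)).symm
  rw [h1, Measure.map_addHaar_smul _ hr.ne', lintegral_smul_measure, smul_eq_mul,
    lintegral_sub_left_eq_self, finrank_euclideanSpace_fin, abs_of_pos (by positivity)]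

/-- `P` is absolutely continuous, so null sets are harmless at every `x`, not merely almost every
one; with `r = 0` this would fail. -/
lemma ae_sub_smul {c : ℝ} (hP : P ≤ ENNReal.ofReal c • (volume : Measure (E n)))
    {q : E n → Prop} (hq : ∀ᵐ y, q y) {r : ℝ} (hr : r ≠ 0) (x : E n) :
    ∀ᵐ z ∂P, q (x - r • z) := by
  have hac : P ≪ (volume : Measure (E n)) :=
    (Measure.absolutelyContinuous_of_le hP).trans Measure.smul_absolutelyContinuous
  refine hac.ae_le ?_
  exact (Measure.quasiMeasurePreserving_smul volume hr).ae
    ((quasiMeasurePreserving_sub_left_of_right_invariant volume x).ae hq)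

lemma measurable_avg [SFinite P] {β : ℝ} {α : Type*} [MeasurableSpace α] {g : α → E n → ℝ}
    {τ : α → ℝ} {x : α → E n}
    (hg : Measurable (Function.uncurry g)) (hτ : Measurable τ) (hx : Measurable x) :
    Measurable fun a => avg P β (τ a) (g a) (x a) := by
  have : Measurable fun q : α × E n =>
      Function.uncurry g (q.1, x q.1 - τ q.1 ^ (1 / β) • q.2) :=
    hg.comp (by fun_prop)
  exact (this.stronglyMeasurable.integral_prod_right' (ν := P)).measurable

/-- Jensen at each point, then Tonelli and translation invariance. The rate `μ` is not worsened. -/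
lemma expInt_avg_le [IsProbabilityMeasure P] {p μ β t : ℝ} (hp : 1 ≤ p) (hμ : 0 ≤ μ) {u : E n → ℝ}
    (hu : Measurable u) : expInt p μ (avg P β t u) ≤ expInt p μ u := by
  rw [expInt, expInt, ← lintegral_lintegral_sub_smul (P := P) (measurable_expInt_integrand p μ hu)
    (t ^ (1 / β))]
  refine lintegral_mono fun x => ?_
  exact exp_abs_integral_le hp hμ (v := fun z => u (x - t ^ (1 / β) • z)) (by fun_prop)

/-- Splitting at height `A`: above it `m ≤ A^{1-q} m^q`. The term `m^q - 1` is kept because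
`e^{μ|u|^p}` itself is not integrable over the whole space. -/
lemma le_add_rpow_mul {q A m : ℝ} (hq : 1 ≤ q) (hA : 1 ≤ A) (hm : 1 ≤ m) :
    m ≤ A + A ^ (1 - q) * (m ^ q - 1) := by
  have hA0 : 0 < A := by linarith
  have hmq : 1 ≤ m ^ q := Real.one_le_rpow hm (by linarith)
  rcases le_total m A with h | h
  · have : 0 ≤ A ^ (1 - q) * (m ^ q - 1) := mul_nonneg (by positivity) (by linarith)
    linarith
  · have h1 : m / A ≤ (m / A) ^ q := Real.self_le_rpow_of_one_le (by rwa [one_le_div hA0]) hq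
    rw [Real.div_rpow (by linarith) hA0.le] at h1
    have h2 : A ^ (1 - q) = A / A ^ q := by rw [Real.rpow_sub hA0, Real.rpow_one]
    have hAq : 1 ≤ A ^ q := Real.one_le_rpow hA (by linarith)
    have hAq0 : 0 < A ^ q := by linarith
    have h3 : m ≤ A / A ^ q * m ^ q := by
      have := mul_le_mul_of_nonneg_left h1 hA0.le
      rw [mul_div_cancel₀ _ hA0.ne'] at this
      calc m ≤ _ := this
        _ = _ := by ring
    have h4 : A / A ^ q ≤ A := div_le_self hA0.le hAq
    rw [h2]
    nlinarith

/-- Smoothing: an average of `exp (κ |u|^p)` is bounded by a multiple of `τ^{-n/(β q)}`. -/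
lemma lintegral_exp_sub_smul_le [IsProbabilityMeasure P] {c : ℝ} (hc : 0 ≤ c)
    (hP : P ≤ ENNReal.ofReal c • (volume : Measure (E n))) {p κ q β B τ : ℝ} (hκ : 0 ≤ κ)
    (hq : 1 ≤ q) (hβ : 0 < β) (hB : 0 ≤ B) (hτ : 0 < τ) (hτ1 : τ ≤ 1) {u : E n → ℝ}
    (hu : Measurable u) (huB : expInt p (κ * q) u ≤ ENNReal.ofReal B) (x : E n) :
    ∫⁻ z, ENNReal.ofReal (Real.exp (κ * |u (x - τ ^ (1 / β) • z)| ^ p)) ∂P ≤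
      ENNReal.ofReal ((1 + c * B) * τ ^ (-(n / (β * q)))) := by
  have hq0 : 0 < q := by linarith
  set θ := n / (β * q) with hθ
  have hθ0 : 0 ≤ θ := by positivity
  -- This height balances the two terms: `A^{1-q} τ^{-n/β} = A`.
  set A := τ ^ (-θ) with hA
  have hA1 : 1 ≤ A := Real.one_le_rpow_of_pos_of_le_one_of_nonpos hτ hτ1 (by linarith)
  have hA0 : 0 < A := by linarith
  have hpt : ∀ y : E n, ENNReal.ofReal (Real.exp (κ * |u y| ^ p)) ≤ ENNReal.ofReal A +
      ENNReal.ofReal (A ^ (1 - q)) * ENNReal.ofReal (Real.exp (κ * q * |u y| ^ p) - 1) := by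
    intro y
    have h1 : 0 ≤ Real.exp (κ * q * |u y| ^ p) - 1 := by
      linarith [Real.one_le_exp (show 0 ≤ κ * q * |u y| ^ p by positivity)]
    rw [← ENNReal.ofReal_mul (by positivity), ← ENNReal.ofReal_add hA0.le (by positivity)]
    refine ENNReal.ofReal_le_ofReal ?_
    have := le_add_rpow_mul hq hA1 (Real.one_le_exp (show 0 ≤ κ * |u y| ^ p by positivity))
    rw [← Real.exp_mul] at this
    convert this using 5
    ring
  have hr : 0 < τ ^ (1 / β) := by positivity
  calc _ ≤ ∫⁻ z, (ENNReal.ofReal A + ENNReal.ofReal (A ^ (1 - q)) *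
        ENNReal.ofReal (Real.exp (κ * q * |u (x - τ ^ (1 / β) • z)| ^ p) - 1)) ∂P :=
        lintegral_mono fun z => hpt _
    _ = ENNReal.ofReal A + ENNReal.ofReal (A ^ (1 - q)) *
        ∫⁻ z, ENNReal.ofReal (Real.exp (κ * q * |u (x - τ ^ (1 / β) • z)| ^ p) - 1) ∂P := by
        rw [lintegral_add_left measurable_const, lintegral_const, measure_univ, mul_one,
          lintegral_const_mul' _ _ ENNReal.ofReal_ne_top]
    _ ≤ ENNReal.ofReal A + ENNReal.ofReal (A ^ (1 - q)) * (ENNReal.ofReal c *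
        (ENNReal.ofReal ((τ ^ (1 / β)) ^ n)⁻¹ * ENNReal.ofReal B)) := by
        gcongr
        refine (lintegral_sub_smul_le hP (measurable_expInt_integrand p (κ * q) hu) hr x).trans ?_
        gcongr
        exact huB
    _ = ENNReal.ofReal (A + A ^ (1 - q) * (c * (((τ ^ (1 / β)) ^ n)⁻¹ * B))) := by
        rw [← ENNReal.ofReal_mul (by positivity), ← ENNReal.ofReal_mul hc,
          ← ENNReal.ofReal_mul (by positivity), ← ENNReal.ofReal_add hA0.le (by positivity)]
    _ = _ := by
        congr 1
        have e : A ^ (1 - q) * ((τ ^ (1 / β)) ^ n)⁻¹ = A := by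
          rw [hA, ← Real.rpow_natCast, ← Real.rpow_mul hτ.le, ← Real.rpow_mul hτ.le,
            ← Real.rpow_neg hτ.le, ← Real.rpow_add hτ]
          congr 1
          rw [hθ]
          field_simp
          ring
        linear_combination (c * B) * e

end avg

/-! ### The Luxemburg norm and the Orlicz heart -/

/-- A modular at most one at scale `l`, that is at rate `l^{-p}`, gives norm at most `l`. With
`eventually_expInt_le_one`, convergence in norm becomes a statement about exponential integrals at
all rates. -/
lemma tendsto_luxNorm_zero {n : ℕ} {ι : Type*} {F : Filter ι} {p : ℝ} {h : ι → E n → ℝ}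
    (H : ∀ μ : ℝ, 0 < μ → ∀ᶠ i in F, expInt p μ (h i) ≤ 1) :
    Tendsto (fun i => luxNorm p (h i)) F (𝓝 0) := by
  rw [ENNReal.tendsto_nhds_zero]
  intro ε hε
  obtain ⟨l, hl0, hl⟩ : ∃ l : ℝ, 0 < l ∧ ENNReal.ofReal l ≤ ε := by
    obtain ⟨l, _, h1, h2⟩ := ENNReal.lt_iff_exists_real_btwn.1 hε
    exact ⟨l, ENNReal.ofReal_pos.1 h1, h2.le⟩
  filter_upwards [H (l ^ p)⁻¹ (by positivity)] with i hi
  rw [← modular_eq_expInt] at hi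
  exact (iInf₂_le_of_le l hl0 (iInf_le_of_le hi le_rfl)).trans hl

lemma eventually_expInt_le_one {n : ℕ} {ι : Type*} {F : Filter ι} {p : ℝ} (hp : 0 < p)
    {h : ι → E n → ℝ} (H : Tendsto (fun i => luxNorm p (h i)) F (𝓝 0)) {μ : ℝ} (hμ : 0 < μ) :
    ∀ᶠ i in F, expInt p μ (h i) ≤ 1 := by
  set l := (μ⁻¹) ^ (1 / p) with hl
  have hl0 : 0 < l := by positivity
  have hlp : l ^ p = μ⁻¹ := by
    rw [hl, ← Real.rpow_mul (by positivity), one_div_mul_cancel hp.ne', Real.rpow_one]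
  filter_upwards [H.eventually_lt_const (ENNReal.ofReal_pos.2 hl0)] with i hi
  simp only [luxNorm, iInf_lt_iff] at hi
  obtain ⟨l', hl', hm, hlt⟩ := hi
  rw [modular_eq_expInt] at hm
  refine (expInt_mono ?_ _).trans hm
  have h1 : l' < l := (ENNReal.ofReal_lt_ofReal_iff hl0).1 hlt
  rw [← inv_inv μ, ← hlp]
  gcongr

/-- The finiteness of all exponential integrals of `u`. -/
def IsHeart {n : ℕ} (p : ℝ) (u : E n → ℝ) : Prop := ∀ μ : ℝ, 0 < μ → expInt p μ u ≠ ⊤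

lemma IsHeart.lpInt_ne_top {n : ℕ} {p : ℝ} (hp : 0 ≤ p) {u : E n → ℝ} (hu : IsHeart p u) :
    lpInt p u ≠ ⊤ := lpInt_ne_top_of_expInt hp one_pos (hu 1 one_pos)

lemma expInt_zero {n : ℕ} {p : ℝ} (hp : p ≠ 0) (μ : ℝ) :
    expInt p μ (fun _ : E n => 0) = 0 := by
  simp [expInt, Real.zero_rpow hp]

lemma expInt_le_of_abs_le {n : ℕ} {p μ M : ℝ} (hp : 0 < p) (hμ : 0 ≤ μ) {b : E n → ℝ}
    (hb : ∀ x, |b x| ≤ M) :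
    expInt p μ b ≤ ENNReal.ofReal (Real.exp (μ * 2 ^ p * M ^ p)) *
      (ENNReal.ofReal (μ * 2 ^ p) * lpInt p b) := by
  have := expInt_add_le_of_abs_le hp.le hμ (a := fun _ => 0) measurable_const hb
  simpa [expInt_zero hp.ne'] using this

lemma isHeart_of_abs_le {n : ℕ} {p M : ℝ} (hp : 0 < p) {b : E n → ℝ}
    (hb : ∀ x, |b x| ≤ M) (hi : lpInt p b ≠ ⊤) : IsHeart p b := fun μ hμ =>
  ne_top_of_le_ne_top (by finiteness) (expInt_le_of_abs_le hp hμ.le hb)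

lemma memLp_iff_lpInt {n : ℕ} {p : ℝ} (hp : 0 < p) {u : E n → ℝ} (hu : Measurable u) :
    MemLp u (ENNReal.ofReal p) volume ↔ lpInt p u ≠ ⊤ := by
  have h1 : ENNReal.ofReal p ≠ 0 := by simpa using hp
  rw [MemLp, and_iff_right hu.aestronglyMeasurable,
    eLpNorm_lt_top_iff_lintegral_rpow_enorm_lt_top h1 ENNReal.ofReal_ne_top,
    ENNReal.toReal_ofReal hp.le, lpInt, lt_top_iff_ne_top]

/-- Write `u = φ - (φ - u)` with a test function `φ` so close that the remainder is controlled at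
rate `μ 2^p`; `φ` is bounded and in `L^p`. -/
lemma isHeart_of_mem_expLZero {n : ℕ} {p : ℝ} (hp : 0 < p) {u : Fn n} (hu : u ∈ expLZero n p) :
    IsHeart p u := by
  obtain ⟨-, φ, hφ, hlim⟩ := hu
  intro μ hμ
  obtain ⟨k, hk⟩ := (eventually_expInt_le_one hp hlim
    (show 0 < μ * 2 ^ p by positivity)).exists
  have hc := (hφ k).1.continuous
  obtain ⟨M, hM⟩ := (hφ k).2.exists_bound_of_continuous hc
  have hl : lpInt p (φ k) ≠ ⊤ :=
    (memLp_iff_lpInt hp hc.measurable).1 (hc.memLp_of_hasCompactSupport (hφ k).2)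
  have hh := isHeart_of_abs_le hp hM hl
  have := expInt_sub_le hp.le hμ.le (a := φ k) (b := fun x => φ k x - u x) hc.measurable
  simp only [sub_sub_cancel] at this
  refine ne_top_of_le_ne_top (ENNReal.add_ne_top.2 ⟨hh _ (by positivity), ?_⟩) this
  exact ne_top_of_le_ne_top ENNReal.one_ne_top hk

/-- Truncation of `u` to the set where `|u| ≤ N`. -/
def trunc {n : ℕ} (N : ℝ) (u : E n → ℝ) (x : E n) : ℝ := if |u x| ≤ N then u x else 0

lemma measurable_trunc {n : ℕ} (N : ℝ) {u : E n → ℝ} (hu : Measurable u) :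
    Measurable (trunc N u) :=
  Measurable.ite (measurableSet_le (by fun_prop) measurable_const) hu measurable_const

lemma abs_trunc_le {n : ℕ} {N : ℝ} (hN : 0 ≤ N) (u : E n → ℝ) (x : E n) : |trunc N u x| ≤ N := by
  unfold trunc
  split_ifs with h <;> simp [h, hN]

lemma abs_trunc_le_abs {n : ℕ} (N : ℝ) (u : E n → ℝ) (x : E n) : |trunc N u x| ≤ |u x| := by
  unfold trunc
  split_ifs with h <;> simp

lemma lpInt_mono {n : ℕ} {p : ℝ} (hp : 0 ≤ p) {u v : E n → ℝ} (h : ∀ x, |u x| ≤ |v x|) :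
    lpInt p u ≤ lpInt p v := by
  refine lintegral_mono fun x => ENNReal.rpow_le_rpow ?_ hp
  rw [Real.enorm_eq_ofReal_abs, Real.enorm_eq_ofReal_abs]
  exact ENNReal.ofReal_le_ofReal (h x)

lemma exists_expInt_sub_trunc_le {n : ℕ} {p μ : ℝ} (hp : 0 < p) {u : E n → ℝ}
    (hu : Measurable u) (hμ : 0 < μ) (hh : IsHeart p u) {ε : ℝ≥0∞} (hε : 0 < ε) :
    ∃ N : ℝ, 0 ≤ N ∧ expInt p μ (fun x => u x - trunc N u x) ≤ ε := by
  have h : Tendsto (fun N : ℕ => expInt p μ (fun x => u x - trunc N u x)) atTop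
      (𝓝 (∫⁻ _ : E n, 0)) := by
    refine tendsto_lintegral_of_dominated_convergence _
      (fun N => measurable_expInt_integrand p μ (hu.sub (measurable_trunc N hu)))
      (fun N => Eventually.of_forall fun x => ENNReal.ofReal_le_ofReal ?_) (hh μ hμ)
      (Eventually.of_forall fun x => ?_)
    · have : |u x - trunc N u x| ≤ |u x| := by
        unfold trunc
        split_ifs <;> simp
      gcongr
    · obtain ⟨N, hN⟩ := exists_nat_ge |u x|
      refine tendsto_const_nhds.congr' ?_
      filter_upwards [eventually_ge_atTop N] with k hk
      have : |u x| ≤ k := hN.trans (by exact_mod_cast hk)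
      simp [trunc, this, Real.zero_rpow hp.ne']
  rw [lintegral_zero] at h
  obtain ⟨N, hN⟩ := ((ENNReal.tendsto_nhds_zero.1 h) ε hε).exists
  exact ⟨N, N.cast_nonneg, hN⟩

/-- Smooth `L^p` approximants of a bounded function need not be bounded; composing them with `χ`
bounds them while keeping smoothness and, up to the factor `L`, the `L^p` error. -/
lemma exists_smooth_clip (N : ℝ) (hN : 0 ≤ N) :
    ∃ χ : ℝ → ℝ, ContDiff ℝ ((⊤ : ℕ∞) : WithTop ℕ∞) χ ∧ (∀ y, |y| ≤ N → χ y = y) ∧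
      (∀ y, |χ y| ≤ N + 2) ∧ ∃ L : NNReal, LipschitzWith L χ := by
  let b : ContDiffBump (0 : ℝ) := ⟨N + 1, N + 2, by linarith, by linarith⟩
  have hsm : ContDiff ℝ ((⊤ : ℕ∞) : WithTop ℕ∞) fun y => y * b y := contDiff_id.mul b.contDiff
  refine ⟨fun y => y * b y, hsm, fun y hy => ?_, fun y => ?_, ?_⟩
  · have : b y = 1 := b.one_of_mem_closedBall (by
      rw [Metric.mem_closedBall, dist_zero_right, Real.norm_eq_abs]
      change |y| ≤ N + 1
      linarith)
    simp [this]
  · by_cases h : |y| ≤ N + 2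
    · rw [abs_mul, abs_of_nonneg b.nonneg]
      exact (mul_le_of_le_one_right (abs_nonneg y) b.le_one).trans h
    · have : b y = 0 := b.zero_of_le_dist (by
        rw [dist_zero_right, Real.norm_eq_abs]
        exact (not_le.1 h).le)
      simp only [this, mul_zero, abs_zero]
      linarith
  · exact hsm.lipschitzWith_of_hasCompactSupport b.hasCompactSupport.mul_left (by simp)

/-- Truncate `u`, approximate the truncation in `L^p` by a test function, and clip. The clipped
error is bounded, so its exponential integral is controlled by its `L^p` size. -/
lemma exists_smooth_expInt_sub_le {n : ℕ} {p μ : ℝ} (hp : 1 ≤ p) {u : E n → ℝ}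
    (hu : Measurable u) (hμ : 0 < μ) (hh : IsHeart p u) :
    ∃ φ : E n → ℝ, ContDiff ℝ ((⊤ : ℕ∞) : WithTop ℕ∞) φ ∧ HasCompactSupport φ ∧
      expInt p μ (fun x => φ x - u x) ≤ 1 := by
  have hp0 : 0 < p := by linarith
  have hμ2 : 0 < μ * 2 ^ p := by positivity
  obtain ⟨N, hN, hNe⟩ := exists_expInt_sub_trunc_le hp0 hu hμ2 hh
    (show (0 : ℝ≥0∞) < ENNReal.ofReal (1 / 2) by simp)
  obtain ⟨χ, hχ, hχid, hχb, L, hL⟩ := exists_smooth_clip N hN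
  set v := trunc N u
  have hv : Measurable v := measurable_trunc N hu
  have hvL : MemLp v (ENNReal.ofReal p) volume := (memLp_iff_lpInt hp0 hv).2
    (ne_top_of_le_ne_top (hh.lpInt_ne_top hp0.le) (lpInt_mono hp0.le (abs_trunc_le_abs N u)))
  -- The constant of `expInt_le_of_abs_le` at rate `μ 2^p` for the error bound `N + (N + 2)`. It
  -- does not depend on the approximant, so `ε` can be fixed beforehand.
  set K := Real.exp (μ * 2 ^ p * 2 ^ p * (N + (N + 2)) ^ p) * (μ * 2 ^ p * 2 ^ p) with hK
  obtain ⟨ε, hε2, hε⟩ : ∃ ε : ℝ, K * (L * ε) ^ p < 1 / 2 ∧ 0 < ε := by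
    have h1 : Tendsto (fun ε : ℝ => K * (L * ε) ^ p) (𝓝[>] 0) (𝓝 (K * (L * 0) ^ p)) := by
      refine Tendsto.mono_left ?_ nhdsWithin_le_nhds
      exact ((tendsto_id.const_mul _).rpow_const (Or.inr hp0.le)).const_mul K
    rw [mul_zero, Real.zero_rpow hp0.ne', mul_zero] at h1
    exact ((h1.eventually_lt_const (by norm_num : (0 : ℝ) < 1 / 2)).and
      self_mem_nhdsWithin).exists
  obtain ⟨g, hgc, hgs, hge⟩ := hvL.exist_eLpNorm_sub_le ENNReal.ofReal_ne_top
    (by simpa using hp) hε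
  refine ⟨χ ∘ g, hχ.comp hgs, hgc.comp_left (hχid 0 (by simpa using hN)), ?_⟩
  have hlp : lpInt p (fun x => v x - χ (g x)) ≤ ENNReal.ofReal ((L * ε) ^ p) := by
    have h1 : (∫⁻ x, ‖v x - g x‖ₑ ^ p) ≤ ENNReal.ofReal (ε ^ p) := by
      rw [eLpNorm_eq_lintegral_rpow_enorm_toReal (by simpa using hp0) ENNReal.ofReal_ne_top,
        ENNReal.toReal_ofReal hp0.le] at hge
      have := ENNReal.rpow_le_rpow hge hp0.le
      rwa [← ENNReal.rpow_mul, one_div_mul_cancel hp0.ne', ENNReal.rpow_one,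
        ENNReal.ofReal_rpow_of_nonneg hε.le hp0.le] at this
    calc lpInt p (fun x => v x - χ (g x))
        ≤ ∫⁻ x, ENNReal.ofReal ((L : ℝ) ^ p) * ‖v x - g x‖ₑ ^ p := by
          refine lintegral_mono fun x => ?_
          simp only
          rw [enorm_rpow_eq_ofReal hp0.le, enorm_rpow_eq_ofReal hp0.le,
            ← ENNReal.ofReal_mul (by positivity),
            ← Real.mul_rpow L.coe_nonneg (abs_nonneg _)]
          refine ENNReal.ofReal_le_ofReal (Real.rpow_le_rpow (abs_nonneg _) ?_ hp0.le)
          have := hL.dist_le_mul (v x) (g x)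
          rwa [hχid (v x) (abs_trunc_le hN u x), Real.dist_eq, Real.dist_eq] at this
      _ ≤ ENNReal.ofReal ((L : ℝ) ^ p) * ENNReal.ofReal (ε ^ p) := by
          rw [lintegral_const_mul' _ _ ENNReal.ofReal_ne_top]
          gcongr
      _ = _ := by
          rw [← ENNReal.ofReal_mul (by positivity), Real.mul_rpow L.coe_nonneg hε.le]
  have hb : ∀ x, |v x - χ (g x)| ≤ N + (N + 2) := fun x =>
    (abs_sub _ _).trans (add_le_add (abs_trunc_le hN u x) (hχb _))
  have h2 := expInt_le_of_abs_le hp0 hμ2.le hb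
  have h3 := expInt_add_le hp0.le hμ.le (a := fun x => u x - v x) (b := fun x => v x - χ (g x))
    (hu.sub hv)
  simp only [sub_add_sub_cancel] at h3
  rw [expInt_sub_comm]
  refine h3.trans ?_
  have h4 : expInt p (μ * 2 ^ p) (fun x => v x - χ (g x)) ≤ ENNReal.ofReal (1 / 2) := by
    refine h2.trans ?_
    rw [← mul_assoc, ← ENNReal.ofReal_mul (by positivity), ← hK]
    calc _ ≤ ENNReal.ofReal K * ENNReal.ofReal ((L * ε) ^ p) := by gcongr
      _ = ENNReal.ofReal (K * (L * ε) ^ p) := by rw [← ENNReal.ofReal_mul (by positivity)]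
      _ ≤ _ := ENNReal.ofReal_le_ofReal hε2.le
  calc _ ≤ ENNReal.ofReal (1 / 2) + ENNReal.ofReal (1 / 2) := add_le_add hNe h4
    _ = 1 := by rw [← ENNReal.ofReal_add (by norm_num) (by norm_num)]; norm_num

lemma locallyIntegrable_of_lpInt {n : ℕ} {p : ℝ} (hp : 1 ≤ p) {u : E n → ℝ}
    (hu : Measurable u) (hi : lpInt p u ≠ ⊤) : LocallyIntegrable u :=
  ((memLp_iff_lpInt (by linarith) hu).2 hi).locallyIntegrable (by simpa using hp)

lemma mem_expLZero_of_isHeart {n : ℕ} {p : ℝ} (hp : 1 ≤ p) {u : Fn n} (hu : IsHeart p u) :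
    u ∈ expLZero n p := by
  have hp0 : 0 < p := by linarith
  have hm : Measurable u := u.measurable
  refine ⟨⟨locallyIntegrable_of_lpInt hp hm (hu.lpInt_ne_top hp0.le), 1, one_pos, ?_⟩, ?_⟩
  · rw [modular_eq_expInt]
    exact (hu _ (by positivity)).lt_top
  -- Taking rate `k + 1` for the `k`-th approximant makes one sequence serve every rate eventually.
  · choose φ hφ1 hφ2 hφ3 using fun k : ℕ =>
      exists_smooth_expInt_sub_le hp hm (show (0 : ℝ) < k + 1 by positivity) hu
    refine ⟨φ, fun k => ⟨hφ1 k, hφ2 k⟩, tendsto_luxNorm_zero fun μ _ => ?_⟩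
    obtain ⟨N, hN⟩ := exists_nat_ge μ
    filter_upwards [eventually_ge_atTop N] with k hk
    refine (expInt_mono ?_ _).trans (hφ3 k)
    have : (N : ℝ) ≤ k := by exact_mod_cast hk
    linarith

/-! ### Continuity of translations and of averages -/

/-- Stated for a general group because it is applied both on `E n` and on the space-time product `ℝ
× E n`. -/
lemma tendsto_lintegral_translate_sub {V : Type*} [NormedAddCommGroup V] [ProperSpace V]
    [MeasurableSpace V] [BorelSpace V] (ν : Measure V) [ν.IsAddHaarMeasure] {p : ℝ} (hp : 1 ≤ p)
    {h : V → ℝ} (hh : MemLp h (ENNReal.ofReal p) ν) :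
    Tendsto (fun y => ∫⁻ x, ‖h (x + y) - h x‖ₑ ^ p ∂ν) (𝓝 0) (𝓝 0) := by
  have hp0 : 0 < p := by linarith
  have : Fact (1 ≤ ENNReal.ofReal p) := ⟨by simpa using hp⟩
  let G : C(V, C(V, V)) := (ContinuousMap.mk (fun q : V × V => q.2 + q.1)
    (by fun_prop)).curry
  have hG : ∀ y, MeasurePreserving (G y) ν ν := fun y => measurePreserving_add_right ν y
  have ht := (tendsto_const_nhds (x := hh.toLp h) (f := 𝓝 (0 : V))).compMeasurePreservingLp
    (g := G) (G.continuous.tendsto 0) hG (hG 0) ENNReal.ofReal_ne_top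
  have h0 : Lp.compMeasurePreserving (G 0) (hG 0) (hh.toLp h) = hh.toLp h := by
    refine Lp.ext ((Lp.coeFn_compMeasurePreserving _ (hG 0)).trans ?_)
    exact Eventually.of_forall fun x => by simp [G]
  rw [h0, tendsto_iff_edist_tendsto_0] at ht
  have ht2 := ((ENNReal.continuous_rpow_const (y := p)).tendsto 0).comp ht
  rw [ENNReal.zero_rpow_of_pos hp0] at ht2
  refine ht2.congr fun y => ?_
  simp only [Function.comp]
  rw [Lp.edist_def, eLpNorm_eq_lintegral_rpow_enorm_toReal (by simpa using hp0)
    ENNReal.ofReal_ne_top, ENNReal.toReal_ofReal hp0.le, ← ENNReal.rpow_mul,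
    one_div_mul_cancel hp0.ne', ENNReal.rpow_one]
  refine lintegral_congr_ae ?_
  have e1 := Lp.coeFn_compMeasurePreserving (hh.toLp h) (hG y)
  have e2 := hh.coeFn_toLp
  have e3 := (hG y).quasiMeasurePreserving.ae_eq_comp e2
  filter_upwards [e1, e2, e3] with x h1 h2 h3
  simp only [Pi.sub_apply, h1, h2, h3]
  rfl

lemma lpInt_translate_sub_le {n : ℕ} {p : ℝ} (hp : 1 ≤ p) {φ : E n → ℝ} (hφ : Measurable φ)
    (y : E n) : ∫⁻ x, ‖φ (x + y) - φ x‖ₑ ^ p ≤ 2 ^ (p - 1) * (lpInt p φ + lpInt p φ) := by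
  have h1 : ∫⁻ x, ‖φ (x + y)‖ₑ ^ p = lpInt p φ :=
    lintegral_add_right_eq_self (fun x => ‖φ x‖ₑ ^ p) y
  calc _ ≤ ∫⁻ x, 2 ^ (p - 1) * (‖φ (x + y)‖ₑ ^ p + ‖φ x‖ₑ ^ p) := by
        refine lintegral_mono fun x => ?_
        exact (ENNReal.rpow_le_rpow enorm_sub_le (by linarith)).trans
          (ENNReal.rpow_add_le_mul_rpow_add_rpow _ _ hp)
    _ = _ := by
        rw [lintegral_const_mul _ (by fun_prop), lintegral_add_left (by fun_prop), h1, lpInt]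

section avg

variable {n : ℕ} {P : Measure (E n)}

lemma enorm_integral_rpow_le {α : Type*} [MeasurableSpace α] {μ : Measure α} (hμ : μ univ ≤ 1)
    {p : ℝ} (hp : 1 < p) {f : α → ℝ} (hf : AEMeasurable f μ) :
    ‖∫ a, f a ∂μ‖ₑ ^ p ≤ ∫⁻ a, ‖f a‖ₑ ^ p ∂μ :=
  (ENNReal.rpow_le_rpow (enorm_integral_le_lintegral_enorm f) (by linarith)).trans
    (rpow_lintegral_le hμ hp hf.enorm)

lemma integrable_sub_smul_of_lpInt [IsProbabilityMeasure P] {c : ℝ}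
    (hP : P ≤ ENNReal.ofReal c • (volume : Measure (E n))) {p β t : ℝ} (hp : 1 ≤ p) (hβ : 0 < β)
    (ht : 0 ≤ t) {u : E n → ℝ} (hu : Measurable u) (hi : lpInt p u ≠ ⊤) (x : E n) :
    Integrable (fun z => u (x - t ^ (1 / β) • z)) P := by
  have hp0 : 0 < p := by linarith
  rcases ht.eq_or_lt with rfl | ht
  · simp [Real.zero_rpow (inv_pos.2 hβ).ne']
  have hm : Measurable fun z => u (x - t ^ (1 / β) • z) := by fun_prop
  have hL : MemLp (fun z => u (x - t ^ (1 / β) • z)) (ENNReal.ofReal p) P := by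
    refine ⟨hm.aestronglyMeasurable, ?_⟩
    rw [eLpNorm_lt_top_iff_lintegral_rpow_enorm_lt_top (by simpa using hp0) ENNReal.ofReal_ne_top,
      ENNReal.toReal_ofReal hp0.le]
    refine (lintegral_sub_smul_le hP (G := fun y => ‖u y‖ₑ ^ p) (by fun_prop)
      (show 0 < t ^ (1 / β) by positivity) x).trans_lt ?_
    rw [lpInt] at hi
    finiteness
  exact hL.integrable (by simpa using hp)

lemma avg_add_of_lpInt [IsProbabilityMeasure P] {c : ℝ}
    (hP : P ≤ ENNReal.ofReal c • (volume : Measure (E n))) {p β t : ℝ} (hp : 1 ≤ p) (hβ : 0 < β)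
    (ht : 0 ≤ t) {u v : E n → ℝ} (hu : Measurable u) (hi : lpInt p u ≠ ⊤) (hv : Measurable v)
    (hj : lpInt p v ≠ ⊤) (x : E n) :
    avg P β t (fun y => u y + v y) x = avg P β t u x + avg P β t v x :=
  integral_add (integrable_sub_smul_of_lpInt hP hp hβ ht hu hi x)
    (integrable_sub_smul_of_lpInt hP hp hβ ht hv hj x)

lemma measurable_avg_const [SFinite P] {β t : ℝ} {g : E n → ℝ} (hg : Measurable g) :
    Measurable (avg P β t g) :=
  measurable_avg (g := fun _ => g) (hg.comp measurable_snd) measurable_const measurable_id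

lemma abs_avg_le [IsProbabilityMeasure P] {β t M : ℝ} {g : E n → ℝ} (hg : ∀ y, |g y| ≤ M)
    (x : E n) : |avg P β t g x| ≤ M := by
  have := norm_integral_le_of_norm_le_const (μ := P)
    (f := fun z => g (x - t ^ (1 / β) • z)) (C := M) (Eventually.of_forall fun z => hg _)
  simpa [avg] using this

/-- Jensen and Tonelli bound the difference by the `P`-mean of the `L^p` modulus of continuity `D`
at `(t₀^{1/β} - t^{1/β}) z`, which is bounded and tends to zero for each `z`. -/
lemma tendsto_lpInt_avg_sub [IsProbabilityMeasure P] {c : ℝ}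
    (hP : P ≤ ENNReal.ofReal c • (volume : Measure (E n))) {p β : ℝ} (hp : 1 < p) (hβ : 0 < β)
    {φ : E n → ℝ} (hφ : Measurable φ) (hi : lpInt p φ ≠ ⊤) {t₀ : ℝ} (ht₀ : 0 ≤ t₀) :
    Tendsto (fun t => lpInt p (fun x => avg P β t φ x - avg P β t₀ φ x)) (𝓝[Ici 0] t₀) (𝓝 0) := by
  have hp1 : 1 ≤ p := hp.le
  have hp0 : 0 < p := by linarith
  set D : E n → ℝ≥0∞ := fun y => ∫⁻ x, ‖φ (x + y) - φ x‖ₑ ^ p with hD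
  have hDm : Measurable D := by
    have : Measurable fun q : E n × E n => ‖φ (q.2 + q.1) - φ q.2‖ₑ ^ p := by fun_prop
    exact this.lintegral_prod_right'
  have hD0 : Tendsto D (𝓝 0) (𝓝 0) :=
    tendsto_lintegral_translate_sub volume hp1 ((memLp_iff_lpInt hp0 hφ).2 hi)
  have hle : ∀ t, 0 ≤ t → lpInt p (fun x => avg P β t φ x - avg P β t₀ φ x) ≤
      ∫⁻ z, D ((t₀ ^ (1 / β) - t ^ (1 / β)) • z) ∂P := by
    intro t ht
    set r := t ^ (1 / β)
    set r₀ := t₀ ^ (1 / β)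
    calc lpInt p (fun x => avg P β t φ x - avg P β t₀ φ x)
        ≤ ∫⁻ x, ∫⁻ z, ‖φ (x - r • z) - φ (x - r₀ • z)‖ₑ ^ p ∂P := by
          refine lintegral_mono fun x => ?_
          simp only [avg]
          rw [← integral_sub (integrable_sub_smul_of_lpInt hP hp1 hβ ht hφ hi x)
            (integrable_sub_smul_of_lpInt hP hp1 hβ ht₀ hφ hi x)]
          exact enorm_integral_rpow_le (by simp) hp (Measurable.aemeasurable (by fun_prop))
      _ = ∫⁻ z, (∫⁻ x, ‖φ (x - r • z) - φ (x - r₀ • z)‖ₑ ^ p) ∂P :=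
          lintegral_lintegral_swap (Measurable.aemeasurable (by fun_prop))
      _ = _ := by
          refine lintegral_congr fun z => ?_
          rw [hD]
          refine Eq.trans ?_ (lintegral_sub_right_eq_self
            (fun x => ‖φ (x + (r₀ - r) • z) - φ x‖ₑ ^ p) (r₀ • z))
          refine lintegral_congr fun x => ?_
          congr 4
          rw [sub_smul]
          abel
  have hlim : Tendsto (fun t : ℝ => ∫⁻ z, D ((t₀ ^ (1 / β) - t ^ (1 / β)) • z) ∂P)
      (𝓝[Ici 0] t₀) (𝓝 (∫⁻ _, 0 ∂P)) := by
    refine tendsto_lintegral_filter_of_dominated_convergence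
      (fun _ => 2 ^ (p - 1) * (lpInt p φ + lpInt p φ))
      (Eventually.of_forall fun t => hDm.comp (measurable_const_smul _))
      (Eventually.of_forall fun t => Eventually.of_forall fun z =>
        lpInt_translate_sub_le hp1 hφ _) ?_ (Eventually.of_forall fun z => hD0.comp ?_)
    · rw [lintegral_const, measure_univ, mul_one]
      have : p - 1 ≥ 0 := by linarith
      finiteness
    · have h1 : Tendsto (fun t : ℝ => t ^ (1 / β)) (𝓝[Ici 0] t₀) (𝓝 (t₀ ^ (1 / β))) :=
        (Real.continuousAt_rpow_const _ _ (Or.inr (by positivity))).tendsto.mono_left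
          nhdsWithin_le_nhds
      have h2 := (h1.const_sub (t₀ ^ (1 / β))).smul_const z
      rwa [sub_self, zero_smul] at h2
  rw [lintegral_zero] at hlim
  refine tendsto_of_tendsto_of_tendsto_of_le_of_le' tendsto_const_nhds hlim
    (Eventually.of_forall fun _ => zero_le) ?_
  filter_upwards [self_mem_nhdsWithin] with t ht using hle t ht

lemma tendsto_expInt_of_tendsto_lpInt {ι : Type*} {F : Filter ι} {p μ M : ℝ} (hp : 0 < p)
    (hμ : 0 ≤ μ) {b : ι → E n → ℝ} (hb : ∀ i x, |b i x| ≤ M)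
    (h : Tendsto (fun i => lpInt p (b i)) F (𝓝 0)) :
    Tendsto (fun i => expInt p μ (b i)) F (𝓝 0) := by
  refine tendsto_of_tendsto_of_tendsto_of_le_of_le tendsto_const_nhds ?_ (fun _ => zero_le)
    (fun i => expInt_le_of_abs_le hp hμ (hb i))
  have h1 := ENNReal.Tendsto.const_mul (a := ENNReal.ofReal (μ * 2 ^ p)) h
    (Or.inr ENNReal.ofReal_ne_top)
  have h2 := ENNReal.Tendsto.const_mul (a := ENNReal.ofReal (Real.exp (μ * 2 ^ p * M ^ p))) h1
    (Or.inr ENNReal.ofReal_ne_top)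
  simpa using h2

/-- The averages of the truncation are bounded, so `L^p` convergence suffices for them; the averages
of the remainder stay as small as the remainder. Two successive splittings cost the factor `2^p ·
2^p` in the rate. -/
lemma tendsto_expInt_avg_sub [IsProbabilityMeasure P] {c : ℝ}
    (hP : P ≤ ENNReal.ofReal c • (volume : Measure (E n))) {p β μ : ℝ} (hp : 1 < p) (hβ : 0 < β)
    (hμ : 0 < μ) {u : E n → ℝ} (hu : Measurable u) (hh : IsHeart p u) {t₀ : ℝ} (ht₀ : 0 ≤ t₀) :
    Tendsto (fun t => expInt p μ (fun x => avg P β t u x - avg P β t₀ u x)) (𝓝[Ici 0] t₀)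
      (𝓝 0) := by
  have hp1 : 1 ≤ p := hp.le
  have hp0 : 0 < p := by linarith
  rw [ENNReal.tendsto_nhds_zero]
  intro ε hε
  have hε3 : 0 < ε / 3 := ENNReal.div_pos hε.ne' (by norm_num)
  have hμ2 : 0 < μ * 2 ^ p := by positivity
  have hμ4 : 0 < μ * 2 ^ p * 2 ^ p := by positivity
  obtain ⟨N, hN, hNe⟩ := exists_expInt_sub_trunc_le hp0 hu hμ4 hh hε3
  set φ := trunc N u
  have hφ : Measurable φ := measurable_trunc N hu
  have hiu := hh.lpInt_ne_top hp0.le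
  have hiφ : lpInt p φ ≠ ⊤ := ne_top_of_le_ne_top hiu (lpInt_mono hp0.le (abs_trunc_le_abs N u))
  have hψ : Measurable fun x => u x - φ x := hu.sub hφ
  have hiψ : lpInt p (fun x => u x - φ x) ≠ ⊤ := by
    refine ne_top_of_le_ne_top hiu (lpInt_mono hp0.le fun x => ?_)
    simp only [φ, trunc]
    split_ifs <;> simp
  have hb : ∀ t x, |avg P β t φ x - avg P β t₀ φ x| ≤ N + N := fun t x =>
    (abs_sub _ _).trans (add_le_add (abs_avg_le (abs_trunc_le hN u) x)
      (abs_avg_le (abs_trunc_le hN u) x))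
  have h1 := tendsto_expInt_of_tendsto_lpInt hp0 hμ2.le hb
    (tendsto_lpInt_avg_sub hP hp hβ hφ hiφ ht₀)
  filter_upwards [ENNReal.tendsto_nhds_zero.1 h1 _ hε3, self_mem_nhdsWithin] with t ht ht0
  have e : ∀ s, 0 ≤ s → ∀ x, avg P β s u x =
      avg P β s (fun y => u y - φ y) x + avg P β s φ x := by
    intro s hs x
    rw [← avg_add_of_lpInt hP hp1 hβ hs hψ hiψ hφ hiφ]
    simp only [sub_add_cancel]
  have e2 : (fun x => avg P β t u x - avg P β t₀ u x) = fun x =>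
      (avg P β t (fun y => u y - φ y) x - avg P β t₀ (fun y => u y - φ y) x) +
      (avg P β t φ x - avg P β t₀ φ x) := by
    funext x
    rw [e t ht0, e t₀ ht₀]
    ring
  rw [e2]
  calc _ ≤ expInt p (μ * 2 ^ p) (fun x => avg P β t (fun y => u y - φ y) x -
          avg P β t₀ (fun y => u y - φ y) x) + ε / 3 := by
        refine (expInt_add_le hp0.le hμ.le
          ((measurable_avg_const hψ).sub (measurable_avg_const hψ))).trans ?_
        exact add_le_add le_rfl ht
    _ ≤ (ε / 3 + ε / 3) + ε / 3 := by
        gcongr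
        refine (expInt_sub_le hp0.le hμ2.le (measurable_avg_const hψ)).trans ?_
        exact add_le_add ((expInt_avg_le hp1 hμ4.le hψ).trans hNe)
          ((expInt_avg_le hp1 hμ4.le hψ).trans hNe)
    _ = ε := ENNReal.add_thirds ε

end avg

/-! ### The nonlinearity -/

lemma abs_integral_le_of_lintegral {α : Type*} [MeasurableSpace α] {μ : Measure α} {g : α → ℝ}
    {K : ℝ} (hK : 0 ≤ K) (h : ∫⁻ a, ‖g a‖ₑ ∂μ ≤ ENNReal.ofReal K) : |∫ a, g a ∂μ| ≤ K := by
  have := (enorm_integral_le_lintegral_enorm g).trans h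
  rwa [Real.enorm_eq_ofReal_abs, ENNReal.ofReal_le_ofReal_iff hK] at this

/-- A nonlinearity vanishing at the origin with Lipschitz constants of exponential growth. -/
structure ExpGrowth (p C lam : ℝ) (f : ℝ → ℝ) : Prop where
  one_lt : 1 < p
  const_pos : 0 < C
  rate_pos : 0 < lam
  map_zero : f 0 = 0
  lip : ∀ a b : ℝ, |f a - f b| ≤
    C * |a - b| * (Real.exp (lam * |a| ^ p) + Real.exp (lam * |b| ^ p))

namespace ExpGrowth

variable {p C lam : ℝ} {f : ℝ → ℝ}

lemma continuous (hf : ExpGrowth p C lam f) : Continuous f := by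
  have hp0 : 0 < p := by linarith [hf.one_lt]
  rw [continuous_iff_continuousAt]
  intro b
  rw [ContinuousAt, tendsto_iff_norm_sub_tendsto_zero]
  have hc : Continuous fun a : ℝ =>
      C * |a - b| * (Real.exp (lam * |a| ^ p) + Real.exp (lam * |b| ^ p)) := by
    have : Continuous fun y : ℝ => |y| ^ p := continuous_abs.rpow_const fun _ => Or.inr hp0.le
    fun_prop
  have h := hc.tendsto b
  simp only [sub_self, abs_zero, mul_zero, zero_mul] at h
  exact squeeze_zero (fun a => norm_nonneg _) (fun a => hf.lip a b) h

lemma abs_le (hf : ExpGrowth p C lam f) (y : ℝ) :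
    |f y| ≤ 2 * C * |y| * Real.exp (lam * |y| ^ p) := by
  have hp0 : 0 < p := by linarith [hf.one_lt]
  have hl := hf.rate_pos
  have hC := hf.const_pos
  have h := hf.lip y 0
  rw [hf.map_zero, sub_zero, sub_zero, abs_zero, Real.zero_rpow hp0.ne', mul_zero,
    Real.exp_zero] at h
  have h1 : 1 ≤ Real.exp (lam * |y| ^ p) := Real.one_le_exp (by positivity)
  have h2 : 0 ≤ C * |y| := by positivity
  nlinarith

lemma abs_le_exp (hf : ExpGrowth p C lam f) (y : ℝ) :
    |f y| ≤ 2 * C * (1 + lam⁻¹) * Real.exp (2 * lam * |y| ^ p) := by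
  have hp := hf.one_lt
  have hl := hf.rate_pos
  have hC := hf.const_pos
  have h0 : 0 ≤ |y| ^ p := by positivity
  have h1 : |y| ≤ 1 + |y| ^ p := by
    rcases le_total |y| 1 with h | h
    · linarith
    · linarith [Real.self_le_rpow_of_one_le h hp.le]
  have h2 : 1 ≤ Real.exp (lam * |y| ^ p) := Real.one_le_exp (by positivity)
  have h3 : |y| ^ p ≤ lam⁻¹ * Real.exp (lam * |y| ^ p) := by
    have := Real.add_one_le_exp (lam * |y| ^ p)
    rw [le_inv_mul_iff₀ hl]
    linarith
  have h4 : |y| ≤ (1 + lam⁻¹) * Real.exp (lam * |y| ^ p) := by linarith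
  calc |f y| ≤ 2 * C * |y| * Real.exp (lam * |y| ^ p) := hf.abs_le y
    _ ≤ 2 * C * ((1 + lam⁻¹) * Real.exp (lam * |y| ^ p)) * Real.exp (lam * |y| ^ p) := by gcongr
    _ = 2 * C * (1 + lam⁻¹) * (Real.exp (lam * |y| ^ p) * Real.exp (lam * |y| ^ p)) := by ring
    _ = _ := by rw [← Real.exp_add]; ring_nf

/-- The bound must vanish at `y = 0` to be integrable over the whole space, so the factor `|y|^p` is
absorbed into `e^{|y|^p} - 1`. -/
lemma abs_rpow_le (hf : ExpGrowth p C lam f) (y : ℝ) :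
    |f y| ^ p ≤ (2 * C) ^ p * (Real.exp ((lam * p + 1) * |y| ^ p) - 1) := by
  have hp0 : 0 < p := by linarith [hf.one_lt]
  have hl := hf.rate_pos
  have hC := hf.const_pos
  set Y := |y| ^ p with hY
  have hY0 : 0 ≤ Y := by positivity
  calc |f y| ^ p ≤ (2 * C * |y| * Real.exp (lam * Y)) ^ p :=
        Real.rpow_le_rpow (abs_nonneg _) (hf.abs_le y) hp0.le
    _ = (2 * C) ^ p * (Y * Real.exp (lam * p * Y)) := by
        rw [Real.mul_rpow (by positivity) (by positivity),
          Real.mul_rpow (by positivity) (by positivity), ← Real.exp_mul, ← hY]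
        ring_nf
    _ ≤ _ := by
        gcongr
        have h1 : 1 ≤ Real.exp (lam * p * Y) := Real.one_le_exp (by positivity)
        have h2 := Real.add_one_le_exp Y
        have h3 : Real.exp ((lam * p + 1) * Y) = Real.exp (lam * p * Y) * Real.exp Y := by
          rw [← Real.exp_add]; ring_nf
        rw [h3]
        nlinarith

/-- The constant and rate are weakened to match `abs_le_exp`, so that one smoothing constant serves
both for size and for differences. -/
lemma abs_sub_le (hf : ExpGrowth p C lam f) (a b : ℝ) :
    |f a - f b| ≤ |a - b| * (C * (1 + lam⁻¹) * (Real.exp (2 * lam * |a| ^ p) +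
      Real.exp (2 * lam * |b| ^ p))) := by
  have hl := hf.rate_pos
  have hC := hf.const_pos
  refine (hf.lip a b).trans ?_
  have ha : Real.exp (lam * |a| ^ p) ≤ Real.exp (2 * lam * |a| ^ p) := by
    gcongr
    linarith
  have hb : Real.exp (lam * |b| ^ p) ≤ Real.exp (2 * lam * |b| ^ p) := by
    gcongr
    linarith
  have h1 : C ≤ C * (1 + lam⁻¹) := le_mul_of_one_le_right hC.le (by
    have := inv_pos.2 hl
    linarith)
  calc _ = |a - b| * (C * (Real.exp (lam * |a| ^ p) + Real.exp (lam * |b| ^ p))) := by ring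
    _ ≤ _ := by gcongr

variable {n : ℕ} {P : Measure (E n)}

lemma lpInt_comp_le (hf : ExpGrowth p C lam f) {B : ℝ} {u : E n → ℝ}
    (hB : expInt p (lam * p + 1) u ≤ ENNReal.ofReal B) :
    lpInt p (fun x => f (u x)) ≤ ENNReal.ofReal ((2 * C) ^ p * B) := by
  have hp0 : 0 < p := by linarith [hf.one_lt]
  have hC := hf.const_pos
  calc lpInt p (fun x => f (u x)) ≤ ∫⁻ x, ENNReal.ofReal ((2 * C) ^ p) *
        ENNReal.ofReal (Real.exp ((lam * p + 1) * |u x| ^ p) - 1) := by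
        refine lintegral_mono fun x => ?_
        simp only
        rw [enorm_rpow_eq_ofReal hp0.le, ← ENNReal.ofReal_mul (by positivity)]
        exact ENNReal.ofReal_le_ofReal (hf.abs_rpow_le _)
    _ ≤ _ := by
        rw [lintegral_const_mul' _ _ ENNReal.ofReal_ne_top, ENNReal.ofReal_mul (by positivity)]
        gcongr
        exact hB

section smoothing

variable [IsProbabilityMeasure P] {c q β B τ : ℝ}

lemma lintegral_enorm_comp_le (hf : ExpGrowth p C lam f) (hc : 0 ≤ c)
    (hP : P ≤ ENNReal.ofReal c • (volume : Measure (E n))) (hq : 1 ≤ q) (hβ : 0 < β) (hB : 0 ≤ B)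
    (hτ : 0 < τ) (hτ1 : τ ≤ 1) {u : E n → ℝ} (hu : Measurable u)
    (huB : expInt p (2 * lam * q) u ≤ ENNReal.ofReal B) (x : E n) :
    ∫⁻ z, ‖f (u (x - τ ^ (1 / β) • z))‖ₑ ∂P ≤
      ENNReal.ofReal (2 * C * (1 + lam⁻¹) * (1 + c * B) * τ ^ (-(n / (β * q)))) := by
  have hl := hf.rate_pos
  have hC := hf.const_pos
  have hK : 0 ≤ 2 * C * (1 + lam⁻¹) := by positivity
  have h := lintegral_exp_sub_smul_le hc hP (by positivity : 0 ≤ 2 * lam) hq hβ hB hτ hτ1 hu huB x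
  calc _ ≤ ∫⁻ z, ENNReal.ofReal (2 * C * (1 + lam⁻¹)) *
        ENNReal.ofReal (Real.exp (2 * lam * |u (x - τ ^ (1 / β) • z)| ^ p)) ∂P := by
        refine lintegral_mono fun z => ?_
        simp only
        rw [Real.enorm_eq_ofReal_abs, ← ENNReal.ofReal_mul hK]
        exact ENNReal.ofReal_le_ofReal (hf.abs_le_exp _)
    _ ≤ ENNReal.ofReal (2 * C * (1 + lam⁻¹)) *
        ENNReal.ofReal ((1 + c * B) * τ ^ (-(n / (β * q)))) := by
        rw [lintegral_const_mul' _ _ ENNReal.ofReal_ne_top]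
        gcongr
    _ = _ := by
        rw [← ENNReal.ofReal_mul hK, ← mul_assoc]

lemma integrable_comp_sub_smul (hf : ExpGrowth p C lam f) (hc : 0 ≤ c)
    (hP : P ≤ ENNReal.ofReal c • (volume : Measure (E n))) (hq : 1 ≤ q) (hβ : 0 < β) (hB : 0 ≤ B)
    (hτ : 0 < τ) (hτ1 : τ ≤ 1) {u : E n → ℝ} (hu : Measurable u)
    (huB : expInt p (2 * lam * q) u ≤ ENNReal.ofReal B) (x : E n) :
    Integrable (fun z => f (u (x - τ ^ (1 / β) • z))) P := by
  have hfm := hf.continuous.measurable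
  refine ⟨Measurable.aestronglyMeasurable (by fun_prop), ?_⟩
  exact (hf.lintegral_enorm_comp_le hc hP hq hβ hB hτ hτ1 hu huB x).trans_lt ENNReal.ofReal_lt_top

lemma abs_avg_comp_le (hf : ExpGrowth p C lam f) (hc : 0 ≤ c)
    (hP : P ≤ ENNReal.ofReal c • (volume : Measure (E n))) (hq : 1 ≤ q) (hβ : 0 < β) (hB : 0 ≤ B)
    (hτ : 0 < τ) (hτ1 : τ ≤ 1) {u : E n → ℝ} (hu : Measurable u)
    (huB : expInt p (2 * lam * q) u ≤ ENNReal.ofReal B) (x : E n) :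
    |avg P β τ (fun y => f (u y)) x| ≤
      2 * C * (1 + lam⁻¹) * (1 + c * B) * τ ^ (-(n / (β * q))) := by
  have hl := hf.rate_pos
  have hC := hf.const_pos
  exact abs_integral_le_of_lintegral (by positivity)
    (hf.lintegral_enorm_comp_le hc hP hq hβ hB hτ hτ1 hu huB x)

lemma abs_avg_comp_sub_le (hf : ExpGrowth p C lam f) (hc : 0 ≤ c)
    (hP : P ≤ ENNReal.ofReal c • (volume : Measure (E n))) (hq : 1 ≤ q) (hβ : 0 < β) (hB : 0 ≤ B)
    (hτ : 0 < τ) (hτ1 : τ ≤ 1) {u v : E n → ℝ} (hu : Measurable u) (hv : Measurable v)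
    (huB : expInt p (2 * lam * q) u ≤ ENNReal.ofReal B)
    (hvB : expInt p (2 * lam * q) v ≤ ENNReal.ofReal B) {δ : ℝ} (hδ : 0 ≤ δ)
    (huv : ∀ᵐ y, |u y - v y| ≤ δ) (x : E n) :
    |avg P β τ (fun y => f (u y)) x - avg P β τ (fun y => f (v y)) x| ≤
      δ * (2 * C * (1 + lam⁻¹) * (1 + c * B) * τ ^ (-(n / (β * q)))) := by
  have hl := hf.rate_pos
  have hC := hf.const_pos
  have hr : 0 < τ ^ (1 / β) := by positivity
  rw [avg, avg, ← integral_sub (hf.integrable_comp_sub_smul hc hP hq hβ hB hτ hτ1 hu huB x)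
    (hf.integrable_comp_sub_smul hc hP hq hβ hB hτ hτ1 hv hvB x)]
  refine abs_integral_le_of_lintegral (by positivity) ?_
  have hK : 0 ≤ δ * (C * (1 + lam⁻¹)) := by positivity
  have h1 := lintegral_exp_sub_smul_le hc hP (by positivity : 0 ≤ 2 * lam) hq hβ hB hτ hτ1 hu huB x
  have h2 := lintegral_exp_sub_smul_le hc hP (by positivity : 0 ≤ 2 * lam) hq hβ hB hτ hτ1 hv hvB x
  calc _ ≤ ∫⁻ z, ENNReal.ofReal (δ * (C * (1 + lam⁻¹))) *
        (ENNReal.ofReal (Real.exp (2 * lam * |u (x - τ ^ (1 / β) • z)| ^ p)) +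
        ENNReal.ofReal (Real.exp (2 * lam * |v (x - τ ^ (1 / β) • z)| ^ p))) ∂P := by
        refine lintegral_mono_ae ?_
        filter_upwards [ae_sub_smul hP huv hr.ne' x] with z hz
        rw [Real.enorm_eq_ofReal_abs, ← ENNReal.ofReal_add (Real.exp_pos _).le (Real.exp_pos _).le,
          ← ENNReal.ofReal_mul hK]
        refine ENNReal.ofReal_le_ofReal ((hf.abs_sub_le _ _).trans ?_)
        rw [mul_assoc δ]
        gcongr
    _ ≤ ENNReal.ofReal (δ * (C * (1 + lam⁻¹))) *
        (ENNReal.ofReal ((1 + c * B) * τ ^ (-(n / (β * q)))) +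
        ENNReal.ofReal ((1 + c * B) * τ ^ (-(n / (β * q))))) := by
        rw [lintegral_const_mul' _ _ ENNReal.ofReal_ne_top, lintegral_add_left (by fun_prop)]
        gcongr
    _ = _ := by
        rw [← ENNReal.ofReal_add (by positivity) (by positivity), ← ENNReal.ofReal_mul hK]
        congr 1
        ring

end smoothing

end ExpGrowth

/-! ### Time integrals -/

section time

variable {n : ℕ} {P : Measure (E n)} {β θ K T : ℝ}

lemma integrableOn_rpow_neg (hθ : θ < 1) (T : ℝ) :
    IntegrableOn (fun σ : ℝ => σ ^ (-θ)) (Ioc 0 T) :=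
  (intervalIntegral.intervalIntegrable_rpow' (a := 0) (b := T) (r := -θ) (by linarith)).1

lemma setIntegral_rpow_neg (hθ : θ < 1) (hT : 0 ≤ T) :
    ∫ σ in Ioc 0 T, σ ^ (-θ) = T ^ (1 - θ) / (1 - θ) := by
  rw [← intervalIntegral.integral_of_le hT, integral_rpow (Or.inl (by linarith)),
    Real.zero_rpow (by linarith), sub_zero]
  congr 1 <;> ring_nf

lemma integrableOn_of_abs_le_rpow (hθ : θ < 1) {F : ℝ → ℝ} (hF : Measurable F)
    (hb : ∀ σ ∈ Ioc 0 T, |F σ| ≤ K * σ ^ (-θ)) : IntegrableOn F (Ioc 0 T) :=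
  ((integrableOn_rpow_neg hθ T).const_mul K).mono' hF.aestronglyMeasurable
    ((ae_restrict_iff' measurableSet_Ioc).2 (Eventually.of_forall hb))

lemma abs_setIntegral_le_of_abs_le_rpow (hθ : θ < 1) (hT : 0 ≤ T) {F : ℝ → ℝ}
    (hb : ∀ σ ∈ Ioc 0 T, |F σ| ≤ K * σ ^ (-θ)) :
    |∫ σ in Ioc 0 T, F σ| ≤ K * (T ^ (1 - θ) / (1 - θ)) := by
  rw [← setIntegral_rpow_neg hθ hT, ← integral_const_mul]
  exact norm_integral_le_of_norm_le (f := F) ((integrableOn_rpow_neg hθ T).const_mul K)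
    ((ae_restrict_iff' measurableSet_Ioc).2 (Eventually.of_forall hb))

/-- Jensen is applied twice, in `z` and in time; the latter is where `T ≤ 1` enters. -/
lemma lpInt_setIntegral_avg_le [IsProbabilityMeasure P] {p : ℝ} (hp : 1 < p) (hT1 : T ≤ 1)
    {H : ℝ → E n → ℝ} (hH : Measurable (Function.uncurry H)) :
    lpInt p (fun x => ∫ σ in Ioc 0 T, avg P β σ (H σ) x) ≤ ∫⁻ σ in Ioc 0 T, lpInt p (H σ) := by
  have hT : (volume.restrict (Ioc 0 T)) univ ≤ 1 := by
    simpa using hT1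
  have hm : Measurable fun q : E n × ℝ => avg P β q.2 (H q.2) q.1 :=
    measurable_avg (g := fun q : E n × ℝ => H q.2)
      (hH.comp (by fun_prop : Measurable fun q : (E n × ℝ) × E n => (q.1.2, q.2)))
      measurable_snd measurable_fst
  have hHσ : ∀ σ, Measurable (H σ) := fun σ => hH.comp measurable_prodMk_left
  calc _ ≤ ∫⁻ x, ∫⁻ σ in Ioc 0 T, ‖avg P β σ (H σ) x‖ₑ ^ p := by
        refine lintegral_mono fun x => ?_
        exact enorm_integral_rpow_le hT hp (hm.comp measurable_prodMk_left).aemeasurable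
    _ = ∫⁻ σ in Ioc 0 T, ∫⁻ x, ‖avg P β σ (H σ) x‖ₑ ^ p :=
        lintegral_lintegral_swap (hm.enorm.pow_const p).aemeasurable
    _ ≤ ∫⁻ σ in Ioc 0 T, lpInt p (H σ) := by
        refine lintegral_mono fun σ => ?_
        simp only [lpInt]
        rw [← lintegral_lintegral_sub_smul (P := P) ((hHσ σ).enorm.pow_const p) (σ ^ (1 / β))]
        refine lintegral_mono fun x => ?_
        exact enorm_integral_rpow_le (by simp) hp
          ((hHσ σ).comp (by fun_prop)).aemeasurable

end time

/-! ### Picard iteration -/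

/-- Banach's fixed point theorem for real functions in the uniform distance. -/
lemma exists_fixed_point_of_half_contraction {α : Type*} {A : (α → ℝ) → Prop}
    {Ψ : (α → ℝ) → α → ℝ} {w₀ : α → ℝ} (h₀ : A w₀) (hΨ : ∀ w, A w → A (Ψ w))
    (hA : ∀ w, A w → ∀ a, |w a| ≤ 1)
    (hlim : ∀ (w : ℕ → α → ℝ) (v : α → ℝ), (∀ k, A (w k)) →
      (∀ a, Tendsto (fun k => w k a) atTop (𝓝 (v a))) → A v)
    (hcon : ∀ w v, A w → A v → ∀ δ : ℝ, 0 ≤ δ → (∀ a, |w a - v a| ≤ δ) →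
      ∀ a, |Ψ w a - Ψ v a| ≤ δ / 2) :
    ∃ w, A w ∧ Ψ w = w := by
  set w : ℕ → α → ℝ := fun k => Ψ^[k] w₀ with hw
  have hsucc : ∀ k, w (k + 1) = Ψ (w k) := fun k => Function.iterate_succ_apply' Ψ k w₀
  have hAw : ∀ k, A (w k) := by
    intro k
    induction k with
    | zero => exact h₀
    | succ k ih => rw [hsucc]; exact hΨ _ ih
  -- The first two iterates lie in `[-1, 1]`, hence the initial gap `2 = 4 / 2`, in the form
  -- expected by the geometric Cauchy criterion.
  have hstep : ∀ k a, |w k a - w (k + 1) a| ≤ 4 / 2 / 2 ^ k := by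
    intro k
    induction k with
    | zero =>
      intro a
      have h1 := hA _ (hAw 0) a
      have h2 := hA _ (hAw 1) a
      have := abs_sub (w 0 a) (w 1 a)
      norm_num
      linarith
    | succ k ih =>
      intro a
      rw [hsucc k, hsucc (k + 1)]
      refine (hcon _ _ (hAw k) (hAw (k + 1)) _ (by positivity) ih a).trans_eq ?_
      rw [pow_succ]
      ring
  have hc : ∀ a, CauchySeq fun k => w k a := fun a => cauchySeq_of_le_geometric_two fun k => by
    rw [Real.dist_eq]; exact hstep k a
  choose v hv using fun a => cauchySeq_tendsto_of_complete (hc a)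
  have hAv : A v := hlim w v hAw hv
  have hdist : ∀ k a, |w k a - v a| ≤ 4 / 2 ^ k := fun k a => by
    have := dist_le_of_le_geometric_two_of_tendsto (C := 4)
      (fun k => by rw [Real.dist_eq]; exact hstep k a) (hv a) k
    rwa [Real.dist_eq] at this
  refine ⟨v, hAv, funext fun a => ?_⟩
  have h1 : Tendsto (fun k => w (k + 1) a) atTop (𝓝 (Ψ v a)) := by
    rw [tendsto_iff_norm_sub_tendsto_zero]
    have h2 : Tendsto (fun k : ℕ => (4 / 2 ^ k / 2 : ℝ)) atTop (𝓝 (4 * 0 / 2)) := by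
      have := (tendsto_pow_atTop_nhds_zero_of_lt_one (r := (1 / 2 : ℝ)) (by norm_num)
        (by norm_num))
      refine ((this.const_mul 4).div_const 2).congr fun k => ?_
      rw [one_div, inv_pow]
      rfl
    rw [mul_zero, zero_div] at h2
    refine squeeze_zero (fun k => norm_nonneg _) (fun k => ?_) h2
    rw [hsucc, Real.norm_eq_abs]
    exact hcon _ _ (hAw k) hAv _ (by positivity) (hdist k) a
  exact tendsto_nhds_unique h1 ((tendsto_add_atTop_iff_nat 1).2 (hv a))

/-- Bounded measurable perturbations with `L^p` norms at most one. -/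
structure Adm {n : ℕ} (p : ℝ) (w : ℝ × E n → ℝ) : Prop where
  meas : Measurable w
  bdd : ∀ q, |w q| ≤ 1
  lp : ∀ t, lpInt p (fun x => w (t, x)) ≤ 1

/-- The `L^p` bound passes to pointwise limits by Fatou's lemma. -/
lemma Adm.of_tendsto {n : ℕ} {p : ℝ} (w : ℕ → ℝ × E n → ℝ) (v : ℝ × E n → ℝ)
    (hw : ∀ k, Adm p (w k)) (hlim : ∀ q, Tendsto (fun k => w k q) atTop (𝓝 (v q))) :
    Adm p v where
  meas := measurable_of_tendsto_metrizable (fun k => (hw k).meas) (tendsto_pi_nhds.2 hlim)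
  bdd q := le_of_tendsto' ((hlim q).abs) fun k => (hw k).bdd q
  lp t := by
    have h1 : ∀ x, liminf (fun k => ‖w k (t, x)‖ₑ ^ p) atTop = ‖v (t, x)‖ₑ ^ p := fun x =>
      (((ENNReal.continuous_rpow_const (y := p)).tendsto _).comp
        ((continuous_enorm.tendsto _).comp (hlim (t, x)))).liminf_eq
    simp only [lpInt, ← h1]
    refine (lintegral_liminf_le fun k =>
      ((hw k).meas.comp measurable_prodMk_left).enorm.pow_const p).trans ?_
    refine liminf_le_of_frequently_le' (Frequently.of_forall fun k => (hw k).lp t)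

section picard

variable {n : ℕ} {p C lam : ℝ} {f : ℝ → ℝ}

/-- The source term `f (a + w)` on the time interval `(0, T]`. -/
def source (f : ℝ → ℝ) (T : ℝ) (a w : ℝ × E n → ℝ) (s : ℝ) (y : E n) : ℝ :=
  if s ∈ Ioc 0 T then f (a (s, y) + w (s, y)) else 0

/-- The Duhamel integral of the source term. -/
def duhamelMap (P : Measure (E n)) (β : ℝ) (f : ℝ → ℝ) (T : ℝ) (a w : ℝ × E n → ℝ)
    (q : ℝ × E n) : ℝ :=
  ∫ σ in Ioc 0 T, avg P β σ (source f T a w (q.1 - σ)) q.2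

lemma measurable_source (hf : ExpGrowth p C lam f) (T : ℝ) {a w : ℝ × E n → ℝ}
    (ha : Measurable a) (hw : Measurable w) :
    Measurable (Function.uncurry (source f T a w)) := by
  refine Measurable.ite (measurable_fst measurableSet_Ioc) ?_ measurable_const
  exact hf.continuous.measurable.comp (ha.add hw)

lemma measurable_avg_source {P : Measure (E n)} [SFinite P] (β : ℝ)
    (hf : ExpGrowth p C lam f) (T : ℝ) {a w : ℝ × E n → ℝ} (ha : Measurable a)
    (hw : Measurable w) :
    Measurable fun q : (ℝ × E n) × ℝ =>
      avg P β q.2 (source f T a w (q.1.1 - q.2)) q.1.2 :=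
  measurable_avg (g := fun q : (ℝ × E n) × ℝ => source f T a w (q.1.1 - q.2))
    ((measurable_source hf T ha hw).comp
      (by fun_prop : Measurable fun q : ((ℝ × E n) × ℝ) × E n => (q.1.1.1 - q.1.2, q.2)))
    measurable_snd (by fun_prop)

/-- Data under which the Picard iteration for `w = ∫ S(t-s) f(a + w) ds` is controlled. -/
structure PicardData (n : ℕ) (P : Measure (E n)) (β p C lam : ℝ) (f : ℝ → ℝ) (c q B T : ℝ)
    (a : ℝ × E n → ℝ) : Prop where
  growth : ExpGrowth p C lam f
  prob : IsProbabilityMeasure P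
  c_nonneg : 0 ≤ c
  le_volume : P ≤ ENNReal.ofReal c • (volume : Measure (E n))
  one_le_q : 1 ≤ q
  β_pos : 0 < β
  exponent : n / (β * q) < 1
  B_nonneg : 0 ≤ B
  T_pos : 0 < T
  T_le_one : T ≤ 1
  meas : Measurable a
  expInt_le : ∀ w, Adm p w → ∀ s,
    expInt p (max (2 * lam * q) (lam * p + 1)) (fun y => a (s, y) + w (s, y)) ≤ ENNReal.ofReal B
  small_sup : 2 * C * (1 + lam⁻¹) * (1 + c * B) *
    (T ^ (1 - n / (β * q)) / (1 - n / (β * q))) ≤ 1 / 2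
  small_lp : T * ((2 * C) ^ p * B) ≤ 1

namespace PicardData

variable {P : Measure (E n)} {β c q B T : ℝ} {a : ℝ × E n → ℝ}

lemma abs_avg_source_le (D : PicardData n P β p C lam f c q B T a) {w : ℝ × E n → ℝ}
    (hw : Adm p w) (s : ℝ) {τ : ℝ} (hτ : τ ∈ Ioc 0 T) (x : E n) :
    |avg P β τ (source f T a w s) x| ≤
      2 * C * (1 + lam⁻¹) * (1 + c * B) * τ ^ (-(n / (β * q))) := by
  have := D.prob
  have hl := D.growth.rate_pos
  have hC := D.growth.const_pos
  have hc := D.c_nonneg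
  have hB := D.B_nonneg
  by_cases hs : s ∈ Ioc 0 T
  · have e : source f T a w s = fun y => f (a (s, y) + w (s, y)) := by
      funext y; simp [source, hs]
    rw [e]
    exact D.growth.abs_avg_comp_le D.c_nonneg D.le_volume D.one_le_q D.β_pos D.B_nonneg hτ.1
      (hτ.2.trans D.T_le_one) (u := fun y => a (s, y) + w (s, y))
      ((D.meas.comp measurable_prodMk_left).add (hw.meas.comp measurable_prodMk_left))
      ((expInt_mono (le_max_left _ _) _).trans (D.expInt_le w hw s)) x
  · have e : source f T a w s = fun y => 0 := by
      funext y; simp [source, hs]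
    rw [e]
    have hτ0 := hτ.1
    simp only [avg, integral_zero, abs_zero]
    positivity

lemma abs_avg_source_sub_le (D : PicardData n P β p C lam f c q B T a) {w v : ℝ × E n → ℝ}
    (hw : Adm p w) (hv : Adm p v) {δ : ℝ} (hδ : 0 ≤ δ) (hwv : ∀ q, |w q - v q| ≤ δ)
    (s : ℝ) {τ : ℝ} (hτ : τ ∈ Ioc 0 T) (x : E n) :
    |avg P β τ (source f T a w s) x - avg P β τ (source f T a v s) x| ≤
      δ * (2 * C * (1 + lam⁻¹) * (1 + c * B) * τ ^ (-(n / (β * q)))) := by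
  have := D.prob
  have hl := D.growth.rate_pos
  have hC := D.growth.const_pos
  have hc := D.c_nonneg
  have hB := D.B_nonneg
  by_cases hs : s ∈ Ioc 0 T
  · have e : ∀ w, source f T a w s = fun y => f (a (s, y) + w (s, y)) := by
      intro w; funext y; simp [source, hs]
    rw [e, e]
    exact D.growth.abs_avg_comp_sub_le D.c_nonneg D.le_volume D.one_le_q D.β_pos D.B_nonneg hτ.1
      (hτ.2.trans D.T_le_one) (u := fun y => a (s, y) + w (s, y))
      (v := fun y => a (s, y) + v (s, y))
      ((D.meas.comp measurable_prodMk_left).add (hw.meas.comp measurable_prodMk_left))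
      ((D.meas.comp measurable_prodMk_left).add (hv.meas.comp measurable_prodMk_left))
      ((expInt_mono (le_max_left _ _) _).trans (D.expInt_le w hw s))
      ((expInt_mono (le_max_left _ _) _).trans (D.expInt_le v hv s)) hδ
      (Eventually.of_forall fun y => by simpa using hwv (s, y)) x
  · have e : ∀ w, source f T a w s = fun y => 0 := by
      intro w; funext y; simp [source, hs]
    rw [e, e]
    have hτ0 := hτ.1
    simp only [avg, integral_zero, sub_self, abs_zero]
    positivity

lemma lpInt_source_le (D : PicardData n P β p C lam f c q B T a) {w : ℝ × E n → ℝ}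
    (hw : Adm p w) (s : ℝ) :
    lpInt p (source f T a w s) ≤ (Ioc 0 T).indicator
      (fun _ => ENNReal.ofReal ((2 * C) ^ p * B)) s := by
  have hp0 : 0 < p := by linarith [D.growth.one_lt]
  by_cases hs : s ∈ Ioc 0 T
  · have e : source f T a w s = fun y => f (a (s, y) + w (s, y)) := by
      funext y; simp [source, hs]
    rw [e, indicator_of_mem hs]
    exact D.growth.lpInt_comp_le (u := fun y => a (s, y) + w (s, y))
      ((expInt_mono (le_max_right _ _) _).trans (D.expInt_le w hw s))
  · have e : source f T a w s = fun y => 0 := by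
      funext y; simp [source, hs]
    rw [e]
    simp [lpInt, hp0]

lemma integrableOn_avg_source (D : PicardData n P β p C lam f c q B T a) {w : ℝ × E n → ℝ}
    (hw : Adm p w) (t : ℝ) (x : E n) :
    IntegrableOn (fun σ => avg P β σ (source f T a w (t - σ)) x) (Ioc 0 T) := by
  have := D.prob
  exact integrableOn_of_abs_le_rpow D.exponent
    ((measurable_avg_source β D.growth T D.meas hw.meas).comp
      (measurable_prodMk_left (x := (t, x)))) fun σ hσ => D.abs_avg_source_le hw (t - σ) hσ x

lemma adm_duhamelMap (D : PicardData n P β p C lam f c q B T a) {w : ℝ × E n → ℝ}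
    (hw : Adm p w) : Adm p (duhamelMap P β f T a w) where
  meas := by
    have := D.prob
    exact ((measurable_avg_source β D.growth T D.meas
      hw.meas).stronglyMeasurable.integral_prod_right'
      (ν := volume.restrict (Ioc 0 T))).measurable
  bdd r := by
    refine (abs_setIntegral_le_of_abs_le_rpow D.exponent D.T_pos.le fun σ hσ =>
      D.abs_avg_source_le hw (r.1 - σ) hσ r.2).trans (D.small_sup.trans (by norm_num))
  lp t := by
    have := D.prob
    have hm : Measurable (Function.uncurry fun σ => source f T a w (t - σ)) :=
      (measurable_source D.growth T D.meas hw.meas).comp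
        (by fun_prop : Measurable fun r : ℝ × E n => (t - r.1, r.2))
    refine (lpInt_setIntegral_avg_le D.growth.one_lt D.T_le_one hm).trans ?_
    calc _ ≤ ∫⁻ _ in Ioc 0 T, ENNReal.ofReal ((2 * C) ^ p * B) :=
          lintegral_mono fun σ => (D.lpInt_source_le hw (t - σ)).trans
            (indicator_le_self _ _ _)
      _ = ENNReal.ofReal (T * ((2 * C) ^ p * B)) := by
          rw [lintegral_const, Measure.restrict_apply_univ, Real.volume_Ioc, sub_zero, mul_comm,
            ENNReal.ofReal_mul D.T_pos.le]
      _ ≤ 1 := by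
          rw [← ENNReal.ofReal_one]
          exact ENNReal.ofReal_le_ofReal D.small_lp

lemma exists_fixed_point (D : PicardData n P β p C lam f c q B T a) :
    ∃ w, Adm p w ∧ duhamelMap P β f T a w = w := by
  have hp0 : 0 < p := by linarith [D.growth.one_lt]
  refine exists_fixed_point_of_half_contraction (A := Adm p) (w₀ := fun _ => 0)
    ⟨measurable_const, fun _ => by simp, fun _ => by simp [lpInt, hp0]⟩
    (fun w hw => D.adm_duhamelMap hw) (fun w hw => hw.bdd) Adm.of_tendsto ?_
  intro w v hw hv δ hδ hwv r
  rw [duhamelMap, duhamelMap, ← integral_sub (D.integrableOn_avg_source hw r.1 r.2)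
    (D.integrableOn_avg_source hv r.1 r.2)]
  have h := abs_setIntegral_le_of_abs_le_rpow (K := δ * (2 * C * (1 + lam⁻¹) * (1 + c * B)))
    D.exponent D.T_pos.le
    (F := fun σ => avg P β σ (source f T a w (r.1 - σ)) r.2 -
      avg P β σ (source f T a v (r.1 - σ)) r.2)
    fun σ hσ => (D.abs_avg_source_sub_le hw hv hδ hwv (r.1 - σ) hσ r.2).trans_eq
      (mul_assoc _ _ _).symm
  refine h.trans ?_
  have := mul_le_mul_of_nonneg_left D.small_sup hδ
  linarith

lemma memLp_source (D : PicardData n P β p C lam f c q B T a) {w : ℝ × E n → ℝ}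
    (hw : Adm p w) :
    MemLp (Function.uncurry (source f T a w)) (ENNReal.ofReal p) volume := by
  have hp0 : 0 < p := by linarith [D.growth.one_lt]
  have hm := measurable_source D.growth T D.meas hw.meas
  refine ⟨hm.aestronglyMeasurable, ?_⟩
  rw [eLpNorm_lt_top_iff_lintegral_rpow_enorm_lt_top (by simpa using hp0) ENNReal.ofReal_ne_top,
    ENNReal.toReal_ofReal hp0.le, Measure.volume_eq_prod,
    lintegral_prod _ (hm.enorm.pow_const p).aemeasurable]
  refine (lintegral_mono fun s => D.lpInt_source_le hw s).trans_lt ?_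
  rw [lintegral_indicator measurableSet_Ioc, lintegral_const, Measure.restrict_apply_univ,
    Real.volume_Ioc]
  finiteness

/-- Changing `t` only translates the source, cut off to `(0, T]`, in time. The difference is the
average of a difference of sources, bounded by its space-time `L^p` size, so continuity of
translations on `ℝ × E n` applies. -/
lemma tendsto_lpInt_duhamelMap_sub (D : PicardData n P β p C lam f c q B T a) {w : ℝ × E n → ℝ}
    (hw : Adm p w) (t₀ : ℝ) :
    Tendsto (fun t => lpInt p (fun x => duhamelMap P β f T a w (t, x) -
      duhamelMap P β f T a w (t₀, x))) (𝓝 t₀) (𝓝 0) := by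
  have := D.prob
  have hp := D.growth.one_lt
  set g := source f T a w with hg
  have hgm : Measurable (Function.uncurry g) := measurable_source D.growth T D.meas hw.meas
  have : (volume : Measure (ℝ × E n)).IsAddHaarMeasure := by
    rw [Measure.volume_eq_prod]
    infer_instance
  have h0 := tendsto_lintegral_translate_sub (volume : Measure (ℝ × E n)) hp.le
    (D.memLp_source hw)
  have h1 : Tendsto (fun t : ℝ => ((t - t₀, 0) : ℝ × E n)) (𝓝 t₀) (𝓝 0) := by
    have : Continuous fun t : ℝ => ((t - t₀, 0) : ℝ × E n) := by fun_prop
    have h := this.tendsto t₀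
    rwa [sub_self] at h
  refine tendsto_of_tendsto_of_tendsto_of_le_of_le tendsto_const_nhds (h0.comp h1)
    (fun _ => zero_le) fun t => ?_
  simp only [Function.comp]
  have hHm : Measurable (Function.uncurry fun σ y => g (t - σ) y - g (t₀ - σ) y) :=
    (hgm.comp (by fun_prop : Measurable fun r : ℝ × E n => (t - r.1, r.2))).sub
      (hgm.comp (by fun_prop : Measurable fun r : ℝ × E n => (t₀ - r.1, r.2)))
  have hm2 : Measurable fun r : ℝ × E n => ‖g (r.1 + (t - t₀)) r.2 - g r.1 r.2‖ₑ ^ p :=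
    ((hgm.comp (by fun_prop : Measurable fun r : ℝ × E n => (r.1 + (t - t₀), r.2))).sub
      hgm).enorm.pow_const p
  have hint : ∀ s, ∀ σ ∈ Ioc 0 T, ∀ x, Integrable (fun z => g s (x - σ ^ (1 / β) • z)) P := by
    intro s σ hσ x
    refine integrable_sub_smul_of_lpInt D.le_volume hp.le D.β_pos hσ.1.le
      (hgm.comp measurable_prodMk_left) (ne_top_of_le_ne_top ?_ (D.lpInt_source_le hw s)) x
    exact ne_top_of_le_ne_top ENNReal.ofReal_ne_top (indicator_le_self _ _ _)
  have e : (fun x => duhamelMap P β f T a w (t, x) - duhamelMap P β f T a w (t₀, x)) =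
      fun x => ∫ σ in Ioc 0 T, avg P β σ (fun y => g (t - σ) y - g (t₀ - σ) y) x := by
    funext x
    rw [duhamelMap, duhamelMap, ← integral_sub (D.integrableOn_avg_source hw t x)
      (D.integrableOn_avg_source hw t₀ x)]
    refine setIntegral_congr_fun measurableSet_Ioc fun σ hσ => ?_
    exact (integral_sub (hint (t - σ) σ hσ x) (hint (t₀ - σ) σ hσ x)).symm
  rw [e]
  calc _ ≤ ∫⁻ σ in Ioc 0 T, lpInt p (fun y => g (t - σ) y - g (t₀ - σ) y) :=
        lpInt_setIntegral_avg_le hp D.T_le_one hHm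
    _ ≤ ∫⁻ σ, lpInt p (fun y => g (t - σ) y - g (t₀ - σ) y) := setLIntegral_le_lintegral _ _
    _ = ∫⁻ s, ∫⁻ y, ‖g (s + (t - t₀)) y - g s y‖ₑ ^ p := by
        refine Eq.trans ?_ (lintegral_sub_left_eq_self
          (fun s => ∫⁻ y, ‖g (s + (t - t₀)) y - g s y‖ₑ ^ p) t₀)
        refine lintegral_congr fun σ => ?_
        simp only [lpInt]
        refine lintegral_congr fun y => ?_
        congr 4
        ring
    _ = _ := by
        rw [Measure.volume_eq_prod, lintegral_prod _ ?_]
        · simp [Function.uncurry, hg]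
        · refine Measurable.aemeasurable ?_
          simpa [Function.uncurry] using hm2

end PicardData

end picard

/-! ### Uniqueness -/

/-- Near `t₀` split `v t = (v t - v t₀) + v t₀`: the first part contributes at most one by
continuity, the second is finite by the heart property. Compactness does the rest. -/
lemma IsContinuousCurve.exists_expInt_le {n : ℕ} {p T : ℝ} (hp : 0 < p) {v : ℝ → Fn n}
    (hv : IsContinuousCurve p T v) {μ : ℝ} (hμ : 0 < μ) :
    ∃ B : ℝ, 0 ≤ B ∧ ∀ t ∈ Icc 0 T, expInt p μ (v t) ≤ ENNReal.ofReal B := by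
  refine isCompact_Icc.induction_on
    (p := fun s => ∃ B : ℝ, 0 ≤ B ∧ ∀ t ∈ s, expInt p μ (v t) ≤ ENNReal.ofReal B)
    ⟨0, le_rfl, fun t ht => ht.elim⟩ ?_ ?_ ?_
  · rintro s s' hss ⟨B, hB, h⟩
    exact ⟨B, hB, fun t ht => h t (hss ht)⟩
  · rintro s s' ⟨B, hB, h⟩ ⟨B', hB', h'⟩
    refine ⟨max B B', hB.trans (le_max_left _ _), fun t ht => ?_⟩
    rcases ht with ht | ht
    · exact (h t ht).trans (ENNReal.ofReal_le_ofReal (le_max_left _ _))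
    · exact (h' t ht).trans (ENNReal.ofReal_le_ofReal (le_max_right _ _))
  · intro t₀ ht₀
    have hμ2 : 0 < μ * 2 ^ p := by positivity
    have hfin := isHeart_of_mem_expLZero hp (hv.mem t₀ ht₀) _ hμ2
    have hne : 1 + expInt p (μ * 2 ^ p) (v t₀) ≠ ⊤ :=
      ENNReal.add_ne_top.2 ⟨ENNReal.one_ne_top, hfin⟩
    refine ⟨_, eventually_expInt_le_one hp (hv.cont t₀ ht₀) hμ2,
      (1 + expInt p (μ * 2 ^ p) (v t₀)).toReal, ENNReal.toReal_nonneg, fun t ht => ?_⟩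
    have h := expInt_add_le hp.le hμ.le (a := fun x => v t x - v t₀ x) (b := v t₀)
      ((v t).measurable.sub (v t₀).measurable)
    simp only [sub_add_cancel] at h
    rw [ENNReal.ofReal_toReal hne]
    have ht' : expInt p (μ * 2 ^ p) (fun x => v t x - v t₀ x) ≤ 1 := ht
    exact h.trans (add_le_add ht' le_rfl)

/-- The weighted singular integral `∫₀¹ exp (-γ σ) σ^{-θ} dσ`. -/
def weightedSingular (θ γ : ℝ) : ℝ := ∫ σ in Ioc (0 : ℝ) 1, Real.exp (-γ * σ) * σ ^ (-θ)

lemma integrableOn_weightedSingular {θ γ : ℝ} (hθ : θ < 1) (hγ : 0 ≤ γ) :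
    IntegrableOn (fun σ : ℝ => Real.exp (-γ * σ) * σ ^ (-θ)) (Ioc 0 1) := by
  refine (integrableOn_rpow_neg hθ 1).bdd_mul (c := 1) (by fun_prop)
    ((ae_restrict_iff' measurableSet_Ioc).2 (Eventually.of_forall fun σ hσ => ?_))
  rw [Real.norm_eq_abs, Real.abs_exp, Real.exp_le_one_iff]
  nlinarith [mul_nonneg hγ hσ.1.le]

lemma tendsto_weightedSingular {θ : ℝ} (hθ : θ < 1) :
    Tendsto (fun k : ℕ => weightedSingular θ k) atTop (𝓝 0) := by
  have h : Tendsto (fun k : ℕ => weightedSingular θ k) atTop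
      (𝓝 (∫ _ in Ioc (0 : ℝ) 1, (0 : ℝ))) := by
    refine tendsto_integral_of_dominated_convergence (fun σ => σ ^ (-θ))
      (fun k => (integrableOn_weightedSingular hθ k.cast_nonneg).aestronglyMeasurable)
      (integrableOn_rpow_neg hθ 1)
      (fun k => (ae_restrict_iff' measurableSet_Ioc).2 (Eventually.of_forall fun σ hσ => ?_))
      ((ae_restrict_iff' measurableSet_Ioc).2 (Eventually.of_forall fun σ hσ => ?_))
    · have hσ0 := hσ.1
      rw [norm_mul, Real.norm_eq_abs, Real.abs_exp, Real.norm_eq_abs,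
        abs_of_nonneg (show 0 ≤ σ ^ (-θ) by positivity)]
      refine mul_le_of_le_one_left (by positivity) (Real.exp_le_one_iff.2 ?_)
      have : (0 : ℝ) ≤ k := k.cast_nonneg
      nlinarith [mul_nonneg this hσ0.le]
    · have h1 : Tendsto (fun k : ℕ => -(k : ℝ) * σ) atTop atBot := by
        have := (tendsto_natCast_atTop_atTop (R := ℝ)).atTop_mul_const hσ.1
        exact (tendsto_neg_atTop_atBot.comp this).congr fun k => (neg_mul _ _).symm
      simpa using (Real.tendsto_exp_atBot.comp h1).mul_const (σ ^ (-θ))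
  simpa using h

/-- Substituting `σ = t - s` gives `e^{γs} = e^{γt} e^{-γσ}`, so the growth `e^{γt}` is reproduced
with a factor that is small for large `γ`. -/
lemma abs_intervalIntegral_le_weightedSingular {θ γ K t : ℝ} (hθ : θ < 1) (hγ : 0 ≤ γ)
    (hK : 0 ≤ K) (ht : 0 ≤ t) (ht1 : t ≤ 1) {F : ℝ → ℝ}
    (hF : ∀ s ∈ Ioo 0 t, |F s| ≤ K * Real.exp (γ * s) * (t - s) ^ (-θ)) :
    |∫ s in (0 : ℝ)..t, F s| ≤ K * weightedSingular θ γ * Real.exp (γ * t) := by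
  have hsub : Ioc 0 t ⊆ Ioc (0 : ℝ) 1 := Ioc_subset_Ioc_right ht1
  have hint := integrableOn_weightedSingular hθ hγ
  set G : ℝ → ℝ := fun σ => K * Real.exp (γ * t) * (Real.exp (-γ * σ) * σ ^ (-θ)) with hG
  have hGi : IntervalIntegrable G volume 0 t := by
    rw [intervalIntegrable_iff_integrableOn_Ioc_of_le ht]
    exact (hint.mono_set hsub).const_mul _
  have hGi2 : IntervalIntegrable (fun s => G (t - s)) volume 0 t := by
    have := hGi.comp_sub_left t
    rw [sub_zero, sub_self] at this
    exact this.symm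
  have h1 : ‖∫ s in (0 : ℝ)..t, F s‖ ≤ ∫ s in (0 : ℝ)..t, G (t - s) := by
    refine intervalIntegral.norm_integral_le_of_norm_le ht ?_ hGi2
    have : ∀ᵐ s : ℝ, s ≠ t := by simp [ae_iff]
    filter_upwards [this] with s hst hs
    refine (hF s ⟨hs.1, lt_of_le_of_ne hs.2 hst⟩).trans_eq ?_
    rw [hG]
    simp only
    have : Real.exp (γ * t) * Real.exp (-γ * (t - s)) = Real.exp (γ * s) := by
      rw [← Real.exp_add]; ring_nf
    rw [← this]
    ring
  rw [intervalIntegral.integral_comp_sub_left G t, sub_self, sub_zero] at h1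
  refine h1.trans ?_
  rw [intervalIntegral.integral_of_le ht, integral_const_mul]
  have h2 : ∫ σ in Ioc 0 t, Real.exp (-γ * σ) * σ ^ (-θ) ≤ weightedSingular θ γ := by
    refine setIntegral_mono_set hint ((ae_restrict_iff' measurableSet_Ioc).2
      (Eventually.of_forall fun σ hσ => ?_)) (LE.le.eventuallyLE hsub)
    have := hσ.1
    positivity
  calc _ ≤ K * Real.exp (γ * t) * weightedSingular θ γ := by gcongr
    _ = _ := by ring

lemma exists_subcritical_exponent (n : ℕ) {β : ℝ} (hβ : 0 < β) :
    ∃ q : ℝ, 1 ≤ q ∧ n / (β * q) < 1 := by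
  have h : 0 ≤ n / β := by positivity
  refine ⟨n / β + 1, by linarith, ?_⟩
  rw [div_lt_one (by positivity), mul_add, mul_div_cancel₀ _ hβ.ne']
  linarith

/-- The Lipschitz estimate after averaging turns an almost everywhere bound at time `s` into a bound
at every `x`, so no null sets accumulate over `s`. Iterating in the weight `e^{γt}` halves the bound
each time. -/
lemma IsMildSolution.unique {n : ℕ} (hn : 1 ≤ n) {p β C lam T : ℝ} {f : ℝ → ℝ} (hβ0 : 0 < β)
    (hβ2 : β < 2) (hf : ExpGrowth p C lam f) {u₀ : Fn n} (hT1 : T ≤ 1) {u v : ℝ → Fn n}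
    (hu : IsMildSolution p β f u₀ T u) (hv : IsMildSolution p β f u₀ T v) :
    ∀ t ∈ Icc 0 T, v t = u t := by
  have hp := hf.one_lt
  have hp0 : 0 < p := by linarith
  have hl := hf.rate_pos
  have hC := hf.const_pos
  have := isProbabilityMeasure_stableLaw hn hβ0 hβ2
  obtain ⟨c, hc, hP⟩ := exists_stableLaw_le hn hβ0
  set P := stableLaw n β
  obtain ⟨q, hq1, hθ⟩ := exists_subcritical_exponent n hβ0
  set θ := n / (β * q) with hθdef
  have hμ : 0 < 2 * lam * q := by positivity
  obtain ⟨B₁, hB₁, huB⟩ := hu.curve.exists_expInt_le hp0 hμ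
  obtain ⟨B₂, hB₂, hvB⟩ := hv.curve.exists_expInt_le hp0 hμ
  set B := max B₁ B₂
  have hB : 0 ≤ B := hB₁.trans (le_max_left _ _)
  replace huB : ∀ t ∈ Icc 0 T, expInt p (2 * lam * q) (u t) ≤ ENNReal.ofReal B := fun t ht =>
    (huB t ht).trans (ENNReal.ofReal_le_ofReal (le_max_left _ _))
  replace hvB : ∀ t ∈ Icc 0 T, expInt p (2 * lam * q) (v t) ≤ ENNReal.ofReal B := fun t ht =>
    (hvB t ht).trans (ENNReal.ofReal_le_ofReal (le_max_right _ _))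
  set Λ := 2 * C * (1 + lam⁻¹) * (1 + c * B) with hΛ
  have hΛ0 : 0 ≤ Λ := by positivity
  have hdiff : ∀ (K γ : ℝ), 0 ≤ K → 0 ≤ γ → ∀ t ∈ Icc 0 T,
      (∀ s ∈ Ioo 0 t, ∀ x, |avg P β (t - s) (fun y => f (u s y)) x -
        avg P β (t - s) (fun y => f (v s y)) x| ≤ K * Real.exp (γ * s) * (t - s) ^ (-θ)) →
      ∀ᵐ x, |u t x - v t x| ≤ K * weightedSingular θ γ * Real.exp (γ * t) := by
    intro K γ hK hγ t ht hb
    filter_upwards [hu.duhamel t ht, hv.duhamel t ht] with x hux hvx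
    rw [hux.2, hvx.2, add_sub_add_left_eq_sub, ← intervalIntegral.integral_sub hux.1 hvx.1]
    refine abs_intervalIntegral_le_weightedSingular hθ hγ hK ht.1 (ht.2.trans hT1) fun s hs => ?_
    rw [semigroup_eq_avg hn hβ0 hβ2 (sub_nonneg.2 hs.2.le),
      semigroup_eq_avg hn hβ0 hβ2 (sub_nonneg.2 hs.2.le)]
    exact hb s hs x
  have hmem : ∀ t ∈ Icc 0 T, ∀ s ∈ Ioo 0 t, s ∈ Icc 0 T ∧ 0 < t - s ∧ t - s ≤ 1 :=
    fun t ht s hs => ⟨⟨hs.1.le, hs.2.le.trans ht.2⟩, sub_pos.2 hs.2, by linarith [hs.1, ht.2]⟩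
  obtain ⟨γ, hγ⟩ : ∃ γ : ℕ, Λ * weightedSingular θ γ ≤ 1 / 2 := by
    have h := (tendsto_weightedSingular hθ).const_mul Λ
    rw [mul_zero] at h
    exact (h.eventually_le_const (by norm_num : (0 : ℝ) < 1 / 2)).exists
  have hγ0 : (0 : ℝ) ≤ γ := γ.cast_nonneg
  -- The a priori bound of the difference, without exponential weight; the factor two is the
  -- triangle inequality for the two sources.
  set M := 2 * Λ * weightedSingular θ 0 with hM
  have hws : 0 ≤ weightedSingular θ 0 := setIntegral_nonneg measurableSet_Ioc fun σ hσ => by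
    have := hσ.1
    positivity
  have hM0 : 0 ≤ M := by positivity
  have key : ∀ k : ℕ, ∀ t ∈ Icc 0 T, ∀ᵐ x,
      |u t x - v t x| ≤ M / 2 ^ k * Real.exp (γ * t) := by
    intro k
    induction k with
    | zero =>
      intro t ht
      have h := hdiff (2 * Λ) 0 (by positivity) le_rfl t ht fun s hs x => by
        obtain ⟨hs1, hs2, hs3⟩ := hmem t ht s hs
        rw [zero_mul, Real.exp_zero, mul_one]
        refine (abs_sub _ _).trans ?_
        have h1 := hf.abs_avg_comp_le hc hP hq1 hβ0 hB hs2 hs3 (u s).measurable (huB s hs1) x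
        have h2 := hf.abs_avg_comp_le hc hP hq1 hβ0 hB hs2 hs3 (v s).measurable (hvB s hs1) x
        linarith
      filter_upwards [h] with x hx
      rw [zero_mul, Real.exp_zero, mul_one] at hx
      rw [pow_zero, div_one]
      exact hx.trans (le_mul_of_one_le_right hM0 (Real.one_le_exp (mul_nonneg hγ0 ht.1)))
    | succ k ih =>
      intro t ht
      have h := hdiff (M / 2 ^ k * Λ) γ (by positivity) hγ0 t ht fun s hs x => by
        obtain ⟨hs1, hs2, hs3⟩ := hmem t ht s hs
        refine (hf.abs_avg_comp_sub_le hc hP hq1 hβ0 hB hs2 hs3 (u s).measurable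
          (v s).measurable (huB s hs1) (hvB s hs1) (by positivity) (ih s hs1) x).trans_eq ?_
        rw [← hΛ]
        ring
      filter_upwards [h] with x hx
      refine hx.trans ?_
      gcongr
      calc M / 2 ^ k * Λ * weightedSingular θ γ = M / 2 ^ k * (Λ * weightedSingular θ γ) := by ring
        _ ≤ M / 2 ^ k * (1 / 2) := by gcongr
        _ = _ := by rw [pow_succ]; ring
  intro t ht
  refine AEEqFun.ext ?_
  filter_upwards [ae_all_iff.2 fun k => key k t ht] with x hx
  have hlim : Tendsto (fun k : ℕ => M / 2 ^ k * Real.exp (γ * t)) atTop (𝓝 0) := by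
    have h := (tendsto_pow_atTop_nhds_zero_of_lt_one (r := (1 / 2 : ℝ)) (by norm_num)
      (by norm_num)).const_mul M
    have h2 := h.mul_const (Real.exp (γ * t))
    rw [mul_zero, zero_mul] at h2
    refine h2.congr fun k => ?_
    rw [one_div, inv_pow, div_eq_mul_inv]
  have := ge_of_tendsto' hlim hx
  have := abs_eq_zero.1 (le_antisymm this (abs_nonneg _))
  linarith

/-! ### Existence -/

lemma exists_small_time {θ Λ K : ℝ} (hθ : θ < 1) :
    ∃ T : ℝ, 0 < T ∧ T ≤ 1 ∧ Λ * (T ^ (1 - θ) / (1 - θ)) ≤ 1 / 2 ∧ T * K ≤ 1 := by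
  have h1 : Tendsto (fun T : ℝ => Λ * (T ^ (1 - θ) / (1 - θ))) (𝓝[>] 0) (𝓝 0) := by
    have : Tendsto (fun T : ℝ => Λ * (T ^ (1 - θ) / (1 - θ))) (𝓝 0)
        (𝓝 (Λ * ((0 : ℝ) ^ (1 - θ) / (1 - θ)))) :=
      ((tendsto_id.rpow_const (Or.inr (by linarith))).div_const _).const_mul _
    rw [Real.zero_rpow (by linarith), zero_div, mul_zero] at this
    exact this.mono_left nhdsWithin_le_nhds
  have h2 : Tendsto (fun T : ℝ => T * K) (𝓝[>] 0) (𝓝 0) := by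
    have : Tendsto (fun T : ℝ => T * K) (𝓝 0) (𝓝 (0 * K)) := tendsto_id.mul_const K
    rw [zero_mul] at this
    exact this.mono_left nhdsWithin_le_nhds
  have h3 : Tendsto (fun T : ℝ => T) (𝓝[>] 0) (𝓝 0) := nhdsWithin_le_nhds
  have h0 : ∀ᶠ T in 𝓝[>] (0 : ℝ), T ∈ Ioi (0 : ℝ) := self_mem_nhdsWithin
  obtain ⟨T, hT⟩ := (h0.and ((h3.eventually_le_const one_pos).and ((h1.eventually_le_const
      (by norm_num : (0 : ℝ) < 1 / 2)).and (h2.eventually_le_const one_pos)))).exists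
  exact ⟨T, hT.1, hT.2.1, hT.2.2.1, hT.2.2.2⟩

lemma expInt_avg_add_le {n : ℕ} {P : Measure (E n)} [IsProbabilityMeasure P] {p β μ : ℝ}
    (hp : 1 ≤ p) (hμ : 0 ≤ μ) {u : E n → ℝ} (hu : Measurable u) {w : ℝ × E n → ℝ} (hw : Adm p w)
    (s : ℝ) :
    expInt p μ (fun y => avg P β s u y + w (s, y)) ≤ ENNReal.ofReal (Real.exp (μ * 2 ^ p)) *
      (expInt p (μ * 2 ^ p) u + ENNReal.ofReal (μ * 2 ^ p)) := by
  have h := expInt_add_le_of_abs_le (p := p) (by linarith) hμ (a := avg P β s u)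
    (b := fun y => w (s, y)) (measurable_avg_const hu) fun y => hw.bdd (s, y)
  rw [Real.one_rpow, mul_one] at h
  refine h.trans ?_
  gcongr
  · exact expInt_avg_le hp (by positivity) hu
  · exact mul_le_of_le_one_right' (hw.lp s)

lemma exists_mildSolution {n : ℕ} (hn : 1 ≤ n) {p β C lam : ℝ} {f : ℝ → ℝ} (hβ0 : 0 < β)
    (hβ2 : β < 2) (hf : ExpGrowth p C lam f) {u₀ : Fn n} (hu₀ : u₀ ∈ expLZero n p) :
    ∃ T : ℝ, 0 < T ∧ T ≤ 1 ∧ ∃ u, IsMildSolution p β f u₀ T u := by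
  have hp := hf.one_lt
  have hp1 := hp.le
  have hp0 : 0 < p := by linarith
  have hl := hf.rate_pos
  have hC := hf.const_pos
  have hprob := isProbabilityMeasure_stableLaw hn hβ0 hβ2
  obtain ⟨c, hc, hP⟩ := exists_stableLaw_le hn hβ0
  set P := stableLaw n β
  obtain ⟨q, hq1, hθ⟩ := exists_subcritical_exponent n hβ0
  have hheart := isHeart_of_mem_expLZero hp0 hu₀
  have hum : Measurable u₀ := u₀.measurable
  set a : ℝ × E n → ℝ := fun r => avg P β r.1 u₀ r.2 with ha
  have ham : Measurable a := measurable_avg (g := fun _ : ℝ × E n => (u₀ : E n → ℝ))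
    (hum.comp measurable_snd) measurable_fst measurable_snd
  set μ := max (2 * lam * q) (lam * p + 1) with hμdef
  have hμ : 0 < μ := lt_of_lt_of_le (by positivity) (le_max_right _ _)
  have hfin : ENNReal.ofReal (Real.exp (μ * 2 ^ p)) *
      (expInt p (μ * 2 ^ p) u₀ + ENNReal.ofReal (μ * 2 ^ p)) ≠ ⊤ := by
    have := hheart (μ * 2 ^ p) (by positivity)
    finiteness
  -- A bound valid for all times and all admissible `w`. It does not involve `T`, so `T` may be
  -- chosen small in terms of `B`.
  set B := (ENNReal.ofReal (Real.exp (μ * 2 ^ p)) *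
      (expInt p (μ * 2 ^ p) u₀ + ENNReal.ofReal (μ * 2 ^ p))).toReal with hBdef
  obtain ⟨T, hT0, hT1, hTs, hTl⟩ := exists_small_time
    (Λ := 2 * C * (1 + lam⁻¹) * (1 + c * B)) (K := (2 * C) ^ p * B) hθ
  have D : PicardData n P β p C lam f c q B T a :=
    { growth := hf, prob := hprob, c_nonneg := hc, le_volume := hP, one_le_q := hq1, β_pos := hβ0
      exponent := hθ, B_nonneg := ENNReal.toReal_nonneg, T_pos := hT0, T_le_one := hT1, meas := ham
      expInt_le := fun w hw s => by
        rw [hBdef, ENNReal.ofReal_toReal hfin]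
        exact expInt_avg_add_le hp1 hμ.le hum hw s
      small_sup := hTs, small_lp := hTl }
  obtain ⟨w, hw, hfix⟩ := D.exists_fixed_point
  have hm : ∀ t, Measurable fun x => a (t, x) + w (t, x) := fun t =>
    (ham.comp measurable_prodMk_left).add (hw.meas.comp measurable_prodMk_left)
  set u : ℝ → Fn n := fun t => AEEqFun.mk (fun x => a (t, x) + w (t, x))
    (hm t).aestronglyMeasurable with hu
  have hae : ∀ t, ∀ᵐ x, u t x = a (t, x) + w (t, x) := fun t => AEEqFun.coeFn_mk _ _
  refine ⟨T, hT0, hT1, u, ⟨fun t ht => mem_expLZero_of_isHeart hp1 fun ν hν => ?_,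
    fun t₀ ht₀ => tendsto_luxNorm_zero fun ν hν => ?_⟩, fun t ht => ?_⟩
  · rw [expInt_congr (hae t)]
    refine ne_top_of_le_ne_top ?_ (expInt_avg_add_le hp1 hν.le hum hw t)
    have := hheart (ν * 2 ^ p) (by positivity)
    finiteness
  · have hν2 : 0 < ν * 2 ^ p := by positivity
    have h1 := (tendsto_expInt_avg_sub hP hp hβ0 hν2 hum hheart ht₀.1).mono_left
      (nhdsWithin_mono t₀ (Icc_subset_Ici_self : Icc 0 T ⊆ Ici 0))
    have h2 := D.tendsto_lpInt_duhamelMap_sub hw t₀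
    rw [hfix] at h2
    have h3 := (tendsto_expInt_of_tendsto_lpInt (M := 2) hp0 hν2.le (fun t x => by
      have h4 := hw.bdd (t, x)
      have h5 := hw.bdd (t₀, x)
      exact (abs_sub _ _).trans (by linarith)) h2).mono_left
      (nhdsWithin_le_nhds (s := Icc 0 T))
    have h6 := h1.add h3
    rw [add_zero] at h6
    filter_upwards [ENNReal.tendsto_nhds_zero.1 h6 1 one_pos] with t ht
    refine le_trans ?_ ht
    have e : (fun x => u t x - u t₀ x) =ᵐ[volume] fun x =>
        (avg P β t u₀ x - avg P β t₀ u₀ x) + (w (t, x) - w (t₀, x)) := by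
      filter_upwards [hae t, hae t₀] with x hx hx0
      rw [hx, hx0]
      simp only [ha]
      ring
    rw [expInt_congr e]
    exact expInt_add_le hp0.le hν.le ((measurable_avg_const hum).sub (measurable_avg_const hum))
  · filter_upwards [hae t] with x hx
    set F : ℝ → ℝ := fun σ => avg P β σ (source f T a w (t - σ)) x with hF
    have hsub : Ioc 0 t ⊆ Ioc 0 T := Ioc_subset_Ioc_right ht.2
    have hFi : IntervalIntegrable F volume 0 t := by
      rw [intervalIntegrable_iff_integrableOn_Ioc_of_le ht.1]
      exact (D.integrableOn_avg_source hw t x).mono_set hsub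
    have hFi2 : IntervalIntegrable (fun s => F (t - s)) volume 0 t := by
      have := hFi.comp_sub_left t
      rw [sub_zero, sub_self] at this
      exact this.symm
    have hcongr : ∀ s ∈ Ioo 0 t,
        F (t - s) = semigroup β (t - s) (fun y => f (u s y)) x := by
      intro s hs
      have hs0 : 0 < t - s := sub_pos.2 hs.2
      have hsT : s ∈ Ioc 0 T := ⟨hs.1, hs.2.le.trans ht.2⟩
      rw [semigroup_eq_avg hn hβ0 hβ2 hs0.le, hF]
      simp only [sub_sub_cancel]
      refine integral_congr_ae ?_
      filter_upwards [ae_sub_smul hP (hae s)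
        (show (t - s) ^ (1 / β) ≠ 0 by positivity) x] with z hz
      rw [hz, source, if_pos hsT]
    have hcongr_ae : ∀ᵐ s : ℝ, s ∈ uIoc 0 t →
        F (t - s) = semigroup β (t - s) (fun y => f (u s y)) x := by
      -- At `s = t` the dilation factor vanishes and the almost everywhere identity for `u s` cannot
      -- be transferred; this single time is discarded.
      have : ∀ᵐ s : ℝ, s ≠ t := by simp [ae_iff]
      filter_upwards [this] with s hst hs
      rw [uIoc_of_le ht.1] at hs
      exact hcongr s ⟨hs.1, lt_of_le_of_ne hs.2 hst⟩
    refine ⟨hFi2.congr_ae ((ae_restrict_iff' measurableSet_uIoc).2 hcongr_ae), ?_⟩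
    rw [← intervalIntegral.integral_congr_ae hcongr_ae, hx,
      intervalIntegral.integral_comp_sub_left F t, sub_self, sub_zero,
      intervalIntegral.integral_of_le ht.1, semigroup_eq_avg hn hβ0 hβ2 ht.1]
    congr 1
    rw [← hfix, duhamelMap]
    -- For `σ > t` the source is evaluated at negative time, where it is zero, so the fixed range
    -- `(0, T]` of `duhamelMap` reduces to `(0, t]`.
    refine setIntegral_eq_of_subset_of_forall_sdiff_eq_zero measurableSet_Ioc hsub fun σ hσ => ?_
    have hσt : t < σ := by
      by_contra h
      exact hσ.2 ⟨hσ.1.1, not_lt.1 h⟩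
    have hnot : t - σ ∉ Ioc 0 T := fun h => by linarith [h.1]
    simp [avg, source, hnot]

end FracHeat

end

/-! ### Local well-posedness -/

theorem theorem1 (n : ℕ) (hn : 1 ≤ n) (p β : ℝ) (hp : 1 < p) (hβ0 : 0 < β) (hβ2 : β < 2)
    (f : ℝ → ℝ) (C lam : ℝ) (hC : 0 < C) (hlam : 0 < lam) (hf0 : f 0 = 0)
    (hf : ∀ a b : ℝ, |f a - f b| ≤
      C * |a - b| * (Real.exp (lam * |a| ^ p) + Real.exp (lam * |b| ^ p)))
    (u₀ : FracHeat.Fn n) (hu₀ : u₀ ∈ FracHeat.expLZero n p) :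
    ∃ T : ℝ, 0 < T ∧ ∃ u : ℝ → FracHeat.Fn n,
      FracHeat.IsMildSolution p β f u₀ T u ∧
      ∀ v : ℝ → FracHeat.Fn n, FracHeat.IsMildSolution p β f u₀ T v →
        ∀ t ∈ Set.Icc 0 T, v t = u t := by
  have hg : FracHeat.ExpGrowth p C lam f := ⟨hp, hC, hlam, hf0, hf⟩
  obtain ⟨T, hT0, hT1, u, hu⟩ := FracHeat.exists_mildSolution hn hβ0 hβ2 hg hu₀
  exact ⟨T, hT0, u, hu, fun v hv => hu.unique hn hβ0 hβ2 hg hT1 hv⟩
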